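/- Let $L$ be a linkoid diagram with $n$ components on $S^2$, i.e. a generic immersion of $n$ copies of $[0,1]$ in $S^2$ with over/under information at its (finitely many, transversal) double points, whose $2n$ endpoints are distinct from each other and from the double points and are labelled by $E=\{1,\dots,2n\}$. Let $\tau$ be its strand permutation (it interchanges the two labels of each component), and let $\sigma$ be a closure permutation, i.e. a fixed point free involution of $E$. Let $V$ be any diagram of the virtual closure $(L_\tau,\sigma)_v$, i.e. an oriented virtual link diagram obtained from $L$ by joining $i$ and $\sigma(i)$, for all $i\in E$, by closure arcs all of whose crossings are virtual; let $L$ carry the orientation induced by $V$. For both diagrams, a state $S$ is a choice of the oriented or the disoriented smoothing at each classical crossing; the labels of these smoothings are $A$ and $A^{-1}$ at a positive crossing, $A^{-1}$ and $A$ at a negative one, and $A^{\alpha(S)}$ is the product of the labels. A disoriented smoothing puts a cusp on each of its two branches, marking one side (that of the angle of the cusp). Two consecutive cusps of a closed component that mark the same side of it cancel. Put $d=-A^2-A^{-2}$ and let $K_1,K_2,\dots$ be variables. The generalized arrow polynomial of $L$ with respect to $\sigma$ is $$\langle L^\sigma\rangle_{\mathcal A}=\sum_S A^{\alpha(S)}\,d^{\,\mathrm{circ}(S)+|E/\langle\tau_S,\sigma\rangle|-1}\,\mathcal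 K_S\in\mathbb Z[A^{\pm1},K_1,K_2,\dots],$$ where $\mathrm{circ}(S)$ is the number of circular components of $S$, $\tau_S$ is the strand permutation of the open components of $S$, the elements of $E/\langle\tau_S,\sigma\rangle$ are the segment cycles (each regarded as a closed component, whose open segments are joined according to $\sigma$), and $\mathcal K_S$ is the product of the $K_i$ over all circular components and segment cycles on which $2i>0$ cusps survive the cancellation. The arrow polynomial of $V$ is $$\langle V\rangle_{\mathcal A}=\sum_S A^{\alpha(S)}\,d^{\,|S|-1}\,\mathcal K_S,$$ where $|S|$ is the number of loops of the state $S$ of $V$ (which may run through virtual crossings), and $\mathcal K_S$ is the product of the $K_i$ over the loops on which $2i>0$ cusps survive. (For $n=0$ both polynomials are taken to be $1$.) Then $$\langle L^\sigma\rangle_{\mathcal A}=\langle V\rangle_{\mathcal A},$$ and, with $\mathsf{Wr}$ denoting the writhe, also the normalized polynomials agree: $$(-A^3)^{-\mathsf{Wr}(L)}\langle L^\sigma\rangle_{\mathcal A}=(-A^3)^{-\mathsf{Wr}(V)}\langle V\rangle_{\mathcal A}.$$ -/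

import Mathlib

open Set
open scoped ContDiff

noncomputable section

/-! ### Generic curves on the 2-sphere

All curves live on the unit sphere of Euclidean 3-space, oriented by the outward normal.
A parameter is a pair (component, time). -/

/-- The determinant with rows `p`, `u`, `v`.  For `p` on the unit sphere and `u`, `v` tangent to
the sphere at `p` it is positive iff `(u, v)` is a positively oriented frame
(outward normal orientation). -/
def tripleDet (p u v : EuclideanSpace ℝ (Fin 3)) : ℝ :=
  Matrix.det !![p 0, p 1, p 2; u 0, u 1, u 2; v 0, v 1, v 2]

/-- Parameters in `dom` whose image point is also the image of another parameter in `dom`. -/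
def doubleParams {P : Type} (dom : Set P) (pt : P → EuclideanSpace ℝ (Fin 3)) : Set P :=
  {x | x ∈ dom ∧ ∃ y ∈ dom, y ≠ x ∧ pt y = pt x}

/-- The only singularities are finitely many transversal double points. -/
structure IsGenericCurve {P : Type} (dom : Set P) (pt vel : P → EuclideanSpace ℝ (Fin 3)) :
    Prop where
  finite : (doubleParams dom pt).Finite
  no_triple : ∀ x ∈ dom, ∀ y ∈ dom, ∀ z ∈ dom, pt x = pt y → pt y = pt z →
    x = y ∨ y = z ∨ x = z
  transverse : ∀ x ∈ dom, ∀ y ∈ dom, x ≠ y → pt x = pt y →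
    tripleDet (pt x) (vel x) (vel y) ≠ 0

/-- A linkoid diagram with `n` components on the 2-sphere, with labelled endpoints: a generic
immersion of `n` copies of `[0,1]`, whose `2 n` endpoints are distinct from each other and from
the double points, with over/under information at every double point.  `label (i, false)` is the
label of the foot (the image of `0`) of component `i`, `label (i, true)` that of its head. -/
structure LinkoidDiagram (n : ℕ) where
  curve : Fin n → ℝ → EuclideanSpace ℝ (Fin 3)
  on_sphere : ∀ i, ∀ t ∈ Icc (0 : ℝ) 1, ‖curve i t‖ = 1
  smooth : ∀ i, ContDiffOn ℝ ∞ (curve i) (Icc 0 1)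
  immersed : ∀ i, ∀ t ∈ Icc (0 : ℝ) 1, derivWithin (curve i) (Icc 0 1) t ≠ 0
  generic : IsGenericCurve {x : Fin n × ℝ | x.2 ∈ Icc (0 : ℝ) 1} (fun x => curve x.1 x.2)
    (fun x => derivWithin (curve x.1) (Icc 0 1) x.2)
  endpoints : ∀ x y : Fin n × ℝ, x.2 = 0 ∨ x.2 = 1 → y.2 ∈ Icc (0 : ℝ) 1 →
    curve y.1 y.2 = curve x.1 x.2 → y = x
  /-- At a double point with parameters `x`, `y`, the strand through `x` is the over-strand
  iff `x ∈ overSet`. -/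
  overSet : Set (Fin n × ℝ)
  over_iff : ∀ x y : Fin n × ℝ, x.2 ∈ Icc (0 : ℝ) 1 → y.2 ∈ Icc (0 : ℝ) 1 → x ≠ y →
    curve x.1 x.2 = curve y.1 y.2 → (x ∈ overSet ↔ y ∉ overSet)
  label : Fin n × Bool ≃ Fin (2 * n)

/-- An oriented virtual link diagram with `m` components on the 2-sphere: a generic immersion of
`m` oriented circles (smooth curves of period `1`, each point of a circle having a unique
parameter in `[0,1)`), each double point being either virtual or classical, with over/under
information at the classical ones. -/
structure VirtualLinkDiagram (m : ℕ) where
  curve : Fin m → ℝ → EuclideanSpace ℝ (Fin 3)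
  periodic : ∀ i, Function.Periodic (curve i) 1
  on_sphere : ∀ i t, ‖curve i t‖ = 1
  smooth : ∀ i, ContDiff ℝ ∞ (curve i)
  immersed : ∀ i t, deriv (curve i) t ≠ 0
  generic : IsGenericCurve {x : Fin m × ℝ | x.2 ∈ Ico (0 : ℝ) 1} (fun x => curve x.1 x.2)
    (fun x => deriv (curve x.1) x.2)
  /-- A double point with parameters `x`, `y` is virtual iff `x ∈ virt`. -/
  virt : Set (Fin m × ℝ)
  virt_iff : ∀ x y : Fin m × ℝ, x.2 ∈ Ico (0 : ℝ) 1 → y.2 ∈ Ico (0 : ℝ) 1 → x ≠ y →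
    curve x.1 x.2 = curve y.1 y.2 → (x ∈ virt ↔ y ∈ virt)
  overSet : Set (Fin m × ℝ)
  over_iff : ∀ x y : Fin m × ℝ, x.2 ∈ Ico (0 : ℝ) 1 → y.2 ∈ Ico (0 : ℝ) 1 → x ≠ y →
    curve x.1 x.2 = curve y.1 y.2 → x ∉ virt → (x ∈ overSet ↔ y ∉ overSet)

/-- The strand permutation: it interchanges the labels of the foot and the head of each
component. -/
def LinkoidDiagram.strandPerm {n : ℕ} (L : LinkoidDiagram n) : Equiv.Perm (Fin (2 * n)) :=
  (L.label.symm.trans ((Equiv.refl (Fin n)).prodCongr Equiv.boolNot)).trans L.label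

/-- Closure permutations: fixed point free involutions of the set of labels. -/
def IsClosurePerm {n : ℕ} (σ : Equiv.Perm (Fin (2 * n))) : Prop :=
  σ * σ = 1 ∧ ∀ e, σ e ≠ e

/-- An orientation of (each component of) a linkoid diagram: `o i = true` means that component `i`
is oriented from its foot to its head, `o i = false` that it is oriented from head to foot. -/
abbrev LinkoidOrientation (n : ℕ) : Type := Fin n → Bool

/-- `VirtualClosure L σ o V` exhibits the oriented virtual link diagram `V` as a diagram of the
virtual closure of `L` with respect to `σ`, such that the orientation of `V` restricts to the
orientation `o` of `L`.  The closure arcs are arbitrary, and all double points on them are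
virtual. -/
structure VirtualClosure {n m : ℕ} (L : LinkoidDiagram n) (σ : Equiv.Perm (Fin (2 * n)))
    (o : LinkoidOrientation n) (V : VirtualLinkDiagram m) where
  /-- the circle of `V` that contains component `i` of `L` -/
  comp : Fin n → Fin m
  /-- every circle of `V` contains a component of `L` -/
  comp_surjective : Function.Surjective comp
  /-- component `i` of `L` is the part of the circle `comp i` with parameters in
  `repar i '' [0,1]` -/
  repar : Fin n → ℝ → ℝ
  repar_smooth : ∀ i, ContDiffOn ℝ ∞ (repar i) (Icc 0 1)
  repar_orientation : ∀ i, ∀ t ∈ Icc (0 : ℝ) 1,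
    0 < (if o i then (1 : ℝ) else -1) * derivWithin (repar i) (Icc 0 1) t
  curve_eq : ∀ i, ∀ t ∈ Icc (0 : ℝ) 1, V.curve (comp i) (repar i t) = L.curve i t
  /-- the components of `L` occupy pairwise disjoint embedded intervals of the circles -/
  disjoint : ∀ i j, ∀ s ∈ Icc (0 : ℝ) 1, ∀ t ∈ Icc (0 : ℝ) 1, comp i = comp j →
    Int.fract (repar i s) = Int.fract (repar j t) → i = j ∧ s = t
  /-- the closure arcs: when a circle of `V` leaves component `i` of `L` at its terminal endpoint,
  the next point of `L` on that circle is the initial endpoint of a component `j`, and `σ` matches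
  these two endpoints -/
  closure_arc : ∀ i, ∃ j, ∃ u : ℝ,
    σ (L.label (i, o i)) = L.label (j, !(o j)) ∧ comp j = comp i ∧
    repar i (if o i then 1 else 0) < u ∧
    Int.fract u = Int.fract (repar j (if o j then 0 else 1)) ∧
    ∀ v ∈ Ioo (repar i (if o i then 1 else 0)) u, ∀ k, ∀ t ∈ Icc (0 : ℝ) 1,
      comp k = comp i → Int.fract v ≠ Int.fract (repar k t)
  /-- a double point of `V` is classical iff it is a double point of `L` -/
  classical_iff : ∀ x y : Fin m × ℝ, x.2 ∈ Ico (0 : ℝ) 1 → y.2 ∈ Ico (0 : ℝ) 1 → x ≠ y →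
    V.curve x.1 x.2 = V.curve y.1 y.2 →
    (x ∉ V.virt ↔
      (∃ i, ∃ t ∈ Icc (0 : ℝ) 1, x = (comp i, Int.fract (repar i t))) ∧
      (∃ j, ∃ s ∈ Icc (0 : ℝ) 1, y = (comp j, Int.fract (repar j s))))
  /-- over/under information at the crossings of `L` is kept -/
  over_iff : ∀ x ∈ doubleParams {x : Fin n × ℝ | x.2 ∈ Icc (0 : ℝ) 1}
      (fun x => L.curve x.1 x.2),
    ((comp x.1, Int.fract (repar x.1 x.2)) ∈ V.overSet ↔ x ∈ L.overSet)

/-! ### Combinatorics of the states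

Both kinds of diagrams are read through their crossings and the arcs joining them. Each classical
crossing has two passages (one on each strand).  A passage `x` has two darts, `(x, true)` leaving
the crossing and `(x, false)` arriving at it, in the sense of the orientation. A node is a dart or
a (labelled) endpoint; each arc of the diagram minus its crossings has two nodes as its ends. -/

/-- Crossings and arcs of an oriented diagram with set `E` of endpoint labels. -/
structure ArcData (E : Type) where
  Passage : Type
  /-- the other passage through the same crossing -/
  partner : Passage → Passage
  /-- the passages on over-strands -/
  overSet : Set Passage
  /-- `turn x` says whether the oriented strands through `x` and through `partner x`, in this
  order, form a positive frame.  If so, going into the crossing along the strand through `x`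
  (in either direction) and leaving it by a disoriented smoothing along the other strand is a
  right turn, and otherwise a left turn: the cusp marks the right, resp. the left, side. -/
  turn : Passage → Bool
  /-- the other end of the arc that ends at the given node -/
  mate : (Passage × Bool) ⊕ E → (Passage × Bool) ⊕ E

namespace ArcData

variable {E : Type} (G : ArcData E)

/-- Darts and endpoints. -/
abbrev Node : Type := (G.Passage × Bool) ⊕ E

/-- A state: the choice of a smoothing at each crossing, `true` for the oriented and `false` for
the disoriented one. -/
def State : Type := {s : G.Passage → Bool // ∀ x, s (G.partner x) = s x}

open Classical in
/-- The sign of the crossing that is met at an over-passage `x`. -/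
def sign (x : G.overSet) : ℤ := if G.turn x then 1 else -1

/-- The writhe. -/
def writhe : ℤ := ∑ᶠ x : G.overSet, G.sign x

/-- The sum of the smoothing labels: a positive crossing has label `1` for the oriented and `-1`
for the disoriented smoothing, a negative crossing the opposite ones. -/
def alpha (s : G.State) : ℤ :=
  ∑ᶠ x : G.overSet, G.sign x * (if s.1 x then 1 else -1)

variable {G}

/-- The smoothing at a crossing joins darts of the two strands: an arriving one with a leaving one
if it is oriented, and two arriving or two leaving ones if it is disoriented. -/
def jump (s : G.State) (d : G.Passage × Bool) : G.Passage × Bool :=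
  (G.partner d.1, if s.1 d.1 then !d.2 else d.2)

/-- Two nodes are adjacent in the state if an arc or a smoothing joins them. -/
def Adj (s : G.State) (a b : G.Node) : Prop :=
  b = G.mate a ∨ ∃ d, a = Sum.inl d ∧ b = Sum.inl (jump s d)

/-- The circular components of a state (that run through a crossing): the connected components
without endpoints. -/
def Circ (s : G.State) : Type :=
  {c : Quot (Adj s) // ∀ e : E, c ≠ Quot.mk _ (Sum.inr e)}

/-- The walk along an open segment of the state: from a node reached at the end of an arc to the
end of the next arc, stopping at endpoints. -/
def segmentStep (s : G.State) : G.Node → G.Node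
  | Sum.inl d => G.mate (Sum.inl (jump s d))
  | Sum.inr e => Sum.inr e

open Classical in
/-- The strand permutation of the state: it sends an endpoint to the other endpoint of its open
segment. -/
def tau (s : G.State) (e : E) : E :=
  if h : ∃ e' : E, ∃ k : ℕ, (segmentStep s)^[k] (G.mate (Sum.inr e)) = Sum.inr e'
  then h.choose else e

/-- The segment cycles of the state with respect to `σ`: the orbits of endpoint labels under the
strand permutation of the state and `σ`. -/
def SegmentCycle (s : G.State) (σ : E → E) : Type :=
  Quot (fun e e' : E => e' = tau s e ∨ e' = σ e)

/-- The walk along the closed components of the state, jumping from `e` to `σ e` at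
endpoints. -/
def walk (s : G.State) (σ : E → E) : G.Node → G.Node
  | Sum.inl d => G.mate (Sum.inl (jump s d))
  | Sum.inr e => G.mate (Sum.inr (σ e))

/-- The cusp passed when the walk leaves the given node: there is one exactly at disoriented
smoothings, recorded by the side that it marks (`true` for right). -/
def cusp (s : G.State) : G.Node → Option Bool
  | Sum.inl d => if s.1 d.1 then none else some (G.turn d.1)
  | Sum.inr _ => none

/-- The cyclic word of cusps that is read in going once around a component from a node on it. -/
def cuspWord (s : G.State) (σ : E → E) (a : G.Node) : List Bool :=
  (List.range (Function.minimalPeriod (walk s σ) a)).filterMap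
    (fun k => cusp s ((walk s σ)^[k] a))

end ArcData

/-- Cyclic words of cusps: two consecutive cusps that mark the same side cancel. -/
inductive CuspMove : List Bool → List Bool → Prop
  | rotate (w : List Bool) : CuspMove w (w.rotate 1)
  | cancel (b : Bool) (w : List Bool) : CuspMove (b :: b :: w) w

/-- The number of pairs of cusps that survive in a cyclic word of cusps. -/
def survivingPairs (w : List Bool) : ℕ :=
  sInf {k | ∃ w', Relation.EqvGen CuspMove w w' ∧ w'.length = k} / 2

/-- The ring of polynomials in `K₁, K₂, …` with coefficients in `ℤ[A, A⁻¹]`. -/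
abbrev ArrowRing : Type := MvPolynomial ℕ+ (LaurentPolynomial ℤ)

/-- The power `A ^ k`. -/
def powA (k : ℤ) : ArrowRing := MvPolynomial.C (LaurentPolynomial.T k)

/-- The loop value `d = -A² - A⁻²`. -/
def loopValue : ArrowRing := -powA 2 - powA (-2)

/-- The variable `K_i`, and `1` for `i = 0` (no surviving cusps). -/
def varK (i : ℕ) : ArrowRing := if h : 0 < i then MvPolynomial.X ⟨i, h⟩ else 1

/-- The factor `(-A ^ 3) ^ (-w)`, which normalizes a state sum of writhe `w`. -/
def writheFactor (w : ℤ) : ArrowRing := (((-1 : ℤˣ) ^ w : ℤˣ) : ℤ) • powA (-3 * w)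

/-! ### The generalized arrow polynomial of a linkoid -/

namespace LinkoidDiagram

variable {n : ℕ} (L : LinkoidDiagram n) (o : LinkoidOrientation n)

/-- The passages through the crossings. -/
def passages : Set (Fin n × ℝ) :=
  doubleParams {x : Fin n × ℝ | x.2 ∈ Icc (0 : ℝ) 1} (fun x => L.curve x.1 x.2)

theorem exists_partner (x : L.passages) :
    ∃ y : L.passages, y ≠ x ∧ L.curve y.1.1 y.1.2 = L.curve x.1.1 x.1.2 := by
  obtain ⟨x, hx, y, hy, hne, he⟩ := x
  exact ⟨⟨y, hy, x, hx, hne.symm, he.symm⟩, fun h => hne (congrArg Subtype.val h), he⟩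

/-- The other passage through the same crossing. -/
def partner (x : L.passages) : L.passages := (L.exists_partner x).choose

/-- The velocity with respect to the orientation `o`. -/
def velocity (x : Fin n × ℝ) : EuclideanSpace ℝ (Fin 3) :=
  (if o x.1 then (1 : ℝ) else -1) • derivWithin (L.curve x.1) (Icc 0 1) x.2

/-- The parameter of a node. -/
def nodeParam : (L.passages × Bool) ⊕ Fin (2 * n) → Fin n × ℝ
  | Sum.inl d => d.1.1
  | Sum.inr e => ((L.label.symm e).1, if (L.label.symm e).2 then 1 else 0)

/-- Whether parameters increase on the arc at a node, in going away from the node. -/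
def increasing : (L.passages × Bool) ⊕ Fin (2 * n) → Prop
  | Sum.inl d => d.2 = o d.1.1.1
  | Sum.inr e => (L.label.symm e).2 = false

/-- There is an arc, free of crossings, from the node `a` to the node `b`, on which parameters
increase. -/
def IsArc (a b : (L.passages × Bool) ⊕ Fin (2 * n)) : Prop :=
  L.increasing o a ∧ ¬ L.increasing o b ∧
  (L.nodeParam a).1 = (L.nodeParam b).1 ∧ (L.nodeParam a).2 < (L.nodeParam b).2 ∧
  ∀ t ∈ Ioo (L.nodeParam a).2 (L.nodeParam b).2, ((L.nodeParam a).1, t) ∉ L.passages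

open Classical in
/-- The crossings and arcs of a linkoid diagram with orientation `o`. -/
def arcData : ArcData (Fin (2 * n)) where
  Passage := L.passages
  partner := L.partner
  overSet := {x | x.1 ∈ L.overSet}
  turn := fun x => decide (0 < tripleDet (L.curve x.1.1 x.1.2) (L.velocity o x.1)
    (L.velocity o (L.partner x).1))
  mate := fun a => if h : ∃ b, L.IsArc o a b ∨ L.IsArc o b a then h.choose else a

/-- The product of the variables `K_i` of the components of a state: over its circular components
and over its segment cycles with respect to `σ`. -/
def stateK (σ : Equiv.Perm (Fin (2 * n))) (s : (L.arcData o).State) : ArrowRing :=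
  (∏ᶠ c : ArcData.Circ s, varK (survivingPairs (ArcData.cuspWord s σ c.1.out))) *
  ∏ᶠ c : ArcData.SegmentCycle s σ,
    varK (survivingPairs (ArcData.cuspWord s σ (Sum.inr (Quot.out c))))

/-- The generalized arrow polynomial of the linkoid diagram `L`, oriented by `o`, with respect
to `σ`. -/
def arrowPolynomial (σ : Equiv.Perm (Fin (2 * n))) : ArrowRing :=
  ∑ᶠ s : (L.arcData o).State,
    powA ((L.arcData o).alpha s) *
    loopValue ^ (Nat.card (ArcData.Circ s) + Nat.card (ArcData.SegmentCycle s σ) - 1) *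
    L.stateK o σ s

end LinkoidDiagram

/-! ### The arrow polynomial of a virtual link diagram -/

namespace VirtualLinkDiagram

variable {m : ℕ} (V : VirtualLinkDiagram m)

/-- The passages through the classical crossings. -/
def passages : Set (Fin m × ℝ) :=
  doubleParams {x : Fin m × ℝ | x.2 ∈ Ico (0 : ℝ) 1} (fun x => V.curve x.1 x.2) \ V.virt

theorem exists_partner (x : V.passages) :
    ∃ y : V.passages, y ≠ x ∧ V.curve y.1.1 y.1.2 = V.curve x.1.1 x.1.2 := by
  obtain ⟨x, ⟨hx, y, hy, hne, he⟩, hv⟩ := x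
  exact ⟨⟨y, ⟨hy, x, hx, hne.symm, he.symm⟩, fun h => hv ((V.virt_iff y x hy hx hne he).1 h)⟩,
    fun h => hne (congrArg Subtype.val h), he⟩

/-- The other passage through the same classical crossing. -/
def partner (x : V.passages) : V.passages := (V.exists_partner x).choose

/-- There is an arc, possibly through virtual crossings but free of classical ones, that starts
with the node `a` and follows the orientation of `V` until the node `b`. -/
def IsArc : (V.passages × Bool) ⊕ Empty → (V.passages × Bool) ⊕ Empty → Prop
  | Sum.inl a, Sum.inl b => a.2 = true ∧ b.2 = false ∧ a.1.1.1 = b.1.1.1 ∧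
      ∃ u : ℝ, a.1.1.2 < u ∧ Int.fract u = b.1.1.2 ∧
        ∀ v ∈ Ioo a.1.1.2 u, (a.1.1.1, Int.fract v) ∉ V.passages
  | _, _ => False

open Classical in
/-- The classical crossings and the arcs of a virtual link diagram, which has no endpoints. -/
def arcData : ArcData Empty where
  Passage := V.passages
  partner := V.partner
  overSet := {x | x.1 ∈ V.overSet}
  turn := fun x => decide (0 < tripleDet (V.curve x.1.1 x.1.2) (deriv (V.curve x.1.1) x.1.2)
    (deriv (V.curve (V.partner x).1.1) (V.partner x).1.2))
  mate := fun a => if h : ∃ b, V.IsArc a b ∨ V.IsArc b a then h.choose else a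

/-- The circles without classical crossings: they are loops without cusps of every state. -/
def freeCircles : ℕ := Nat.card {i : Fin m // ∀ t : ℝ, (i, t) ∉ V.passages}

/-- The arrow polynomial of a virtual link diagram (not normalized). -/
def arrowPolynomial : ArrowRing :=
  ∑ᶠ s : V.arcData.State,
    powA (V.arcData.alpha s) *
    loopValue ^ (Nat.card (ArcData.Circ s) + V.freeCircles - 1) *
    ∏ᶠ c : ArcData.Circ s, varK (survivingPairs (ArcData.cuspWord s id c.1.out))

end VirtualLinkDiagram

end

/-!
Join the open segments of a state of `L` according to `σ`. The closed components of the result are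
the circular components and the segment cycles, and a walk along one of them is a composition of
two involutions: one passes a smoothing or a closure arc, the other passes an arc of the diagram.
Since the closure arcs of `V` have virtual crossings only, the walk along the corresponding state
of `V` is the map of first return of this walk to the darts of the crossings. As there are no cusps
at endpoints, both walks read the same cyclic words of cusps. So the closed components that run
through a crossing are the loops of `V` that run through a classical crossing, with the same
factors `K_i`. The other closed components carry no cusps, and they are the circles of `V` without
classical crossings.
-/

/-! ### Cyclic words of cusps -/

theorem isRotated_filterMap {α β : Type*} (c : α → Option β) {l l' : List α}
    (h : l.IsRotated l') : (l.filterMap c).IsRotated (l'.filterMap c) := by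
  obtain ⟨n, hn, rfl⟩ := List.isRotated_iff_mod.1 h
  rw [List.rotate_eq_drop_append_take hn, List.filterMap_append]
  conv_lhs => rw [← List.take_append_drop n l, List.filterMap_append]
  exact List.isRotated_append

theorem eqvGen_cuspMove_of_isRotated {w w' : List Bool} (h : w.IsRotated w') :
    Relation.EqvGen CuspMove w w' := by
  obtain ⟨n, rfl⟩ := h
  induction n with
  | zero =>
    rw [List.rotate_zero]
    exact .refl _
  | succ n ih =>
    rw [← List.rotate_rotate]
    exact ih.trans _ _ _ (.rel _ _ (.rotate _))

/-- The word of cusps that is read in the opposite direction: the order of the cusps is reversed,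
and left and right are interchanged. -/
def reversedWord (w : List Bool) : List Bool := (w.map not).reverse

theorem reversedWord_involutive : Function.Involutive reversedWord := fun w => by
  simp [reversedWord, Function.comp_def]

theorem length_reversedWord (w : List Bool) : (reversedWord w).length = w.length := by
  simp [reversedWord]

theorem CuspMove.eqvGen_reversedWord {w w' : List Bool} (h : CuspMove w w') :
    Relation.EqvGen CuspMove (reversedWord w) (reversedWord w') := by
  cases h with
  | rotate =>
    exact eqvGen_cuspMove_of_isRotated (List.IsRotated.reverse (.map ⟨1, rfl⟩ not))
  | cancel b =>
    have hrot : (reversedWord w' ++ [!b, !b]).IsRotated ([!b, !b] ++ reversedWord w') :=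
      List.isRotated_append
    have hrev : reversedWord (b :: b :: w') = reversedWord w' ++ [!b, !b] := by
      simp [reversedWord]
    rw [hrev]
    exact (eqvGen_cuspMove_of_isRotated hrot).trans _ _ _ (.rel _ _ (.cancel _ _))

theorem eqvGen_cuspMove_reversedWord_iff {w w' : List Bool} :
    Relation.EqvGen CuspMove (reversedWord w) (reversedWord w') ↔
      Relation.EqvGen CuspMove w w' := by
  have map_reversedWord : ∀ {v v' : List Bool}, Relation.EqvGen CuspMove v v' →
      Relation.EqvGen CuspMove (reversedWord v) (reversedWord v') := fun h => by
    induction h with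
    | rel _ _ h => exact h.eqvGen_reversedWord
    | refl _ => exact .refl _
    | symm _ _ _ ih => exact ih.symm
    | trans _ _ _ _ _ ih ih' => exact ih.trans _ _ _ ih'
  refine ⟨fun h => ?_, map_reversedWord⟩
  simpa only [reversedWord_involutive _] using map_reversedWord h

theorem survivingPairs_congr {w w' : List Bool} (h : Relation.EqvGen CuspMove w w') :
    survivingPairs w = survivingPairs w' := by
  have h_iff (v : List Bool) : Relation.EqvGen CuspMove w v ↔ Relation.EqvGen CuspMove w' v :=
    ⟨h.symm.trans _ _ _, h.trans _ _ _⟩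
  simp only [survivingPairs, h_iff]

theorem survivingPairs_reversedWord (w : List Bool) :
    survivingPairs (reversedWord w) = survivingPairs w := by
  have h_set : {k | ∃ v, Relation.EqvGen CuspMove (reversedWord w) v ∧ v.length = k} =
      {k | ∃ v, Relation.EqvGen CuspMove w v ∧ v.length = k} := by
    ext k
    rw [mem_ofPred_eq, reversedWord_involutive.surjective.exists]
    simp only [eqvGen_cuspMove_reversedWord_iff, length_reversedWord, mem_ofPred_eq]
  rw [survivingPairs, survivingPairs, h_set]

theorem survivingPairs_nil : survivingPairs [] = 0 := by
  have : sInf {k | ∃ v, Relation.EqvGen CuspMove [] v ∧ v.length = k} = 0 :=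
    Nat.sInf_eq_zero.2 (.inl ⟨[], .refl _, rfl⟩)
  rw [survivingPairs, this]

theorem involutive_id {α : Type*} : Function.Involutive (id : α → α) := fun _ => rfl

/-! ### Compositions of involutions and first returns -/

section Involutions

variable {α : Type*} {μ ρ : α → α} (hμ : Function.Involutive μ) (hρ : Function.Involutive ρ)
include hμ hρ

theorem comp_apply_comp_of_involutive (a : α) : (μ ∘ ρ) (μ ((μ ∘ ρ) a)) = μ a := by
  simp only [Function.comp_apply, hμ (ρ a), hρ a]

theorem iterate_comp_apply_iterate_comp (k : ℕ) (a : α) :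
    (μ ∘ ρ)^[k] (μ ((μ ∘ ρ)^[k] a)) = μ a := by
  induction k generalizing a with
  | zero => rfl
  | succ k ih =>
    rw [Function.iterate_succ_apply, Function.iterate_succ_apply',
      comp_apply_comp_of_involutive hμ hρ, ih]

theorem listIterate_comp_of_involutive (k : ℕ) (a : α) :
    List.iterate (μ ∘ ρ) (μ ((μ ∘ ρ)^[k] a)) k =
      ((List.iterate (μ ∘ ρ) a k).reverse).map ρ := by
  induction k with
  | zero => rfl
  | succ k ih =>
    rw [List.iterate_add (μ ∘ ρ) a k 1, List.iterate, Function.iterate_succ_apply',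
      comp_apply_comp_of_involutive hμ hρ, ih, Function.comp_apply, hμ]
    simp

theorem minimalPeriod_comp_of_involutive (a : α) :
    Function.minimalPeriod (μ ∘ ρ) (μ a) = Function.minimalPeriod (μ ∘ ρ) a := by
  have periodic {k : ℕ} {b : α} (h : Function.IsPeriodicPt (μ ∘ ρ) k b) :
      Function.IsPeriodicPt (μ ∘ ρ) k (μ b) := by
    have := iterate_comp_apply_iterate_comp hμ hρ k b
    rwa [h.eq] at this
  refine Function.minimalPeriod_eq_minimalPeriod_iff.2 fun k => ⟨fun h => ?_, periodic⟩
  simpa only [hμ a] using periodic h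

end Involutions

/-- `g` is the map of first return to the subset `ι : β → α` under `f`, and `r b` is the time of
the first return of `b`. -/
structure IsFirstReturn {α β : Type*} (ι : β → α) (f : α → α) (g : β → β) (r : β → ℕ) :
    Prop where
  pos : ∀ b, 0 < r b
  iterate_apply : ∀ b, f^[r b] (ι b) = ι (g b)
  notMem_range : ∀ b k, 0 < k → k < r b → f^[k] (ι b) ∉ range ι

theorem exists_isFirstReturn {α β : Type*} [Finite α] {ι : β → α} {f : α → α} {g : β → β}
    (hf : Function.Injective f)
    (hg : ∀ b k, 0 < k → (∀ i, 0 < i → i < k → f^[i] (ι b) ∉ range ι) →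
      f^[k] (ι b) ∈ range ι → f^[k] (ι b) = ι (g b)) :
    ∃ r, IsFirstReturn ι f g r := by
  classical
  have returns (b : β) : ∃ k, 0 < k ∧ f^[k] (ι b) ∈ range ι := by
    obtain ⟨k, hk, hper⟩ := hf.mem_periodicPts (ι b)
    exact ⟨k, hk, b, hper.symm⟩
  have before (b : β) (k : ℕ) (hk : 0 < k) (hlt : k < Nat.find (returns b)) :
      f^[k] (ι b) ∉ range ι := fun h => Nat.find_min _ hlt ⟨hk, h⟩
  exact ⟨fun b => Nat.find (returns b), fun b => (Nat.find_spec (returns b)).1,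
    fun b => hg b _ (Nat.find_spec (returns b)).1 (before b) (Nat.find_spec (returns b)).2,
    before⟩

namespace IsFirstReturn

variable {α β : Type*} {ι : β → α} {f : α → α} {g : β → β} {r : β → ℕ}
  (h : IsFirstReturn ι f g r)
include h

theorem iterate_birkhoffSum (j : ℕ) (b : β) : f^[birkhoffSum g r j b] (ι b) = ι (g^[j] b) := by
  induction j with
  | zero => simp
  | succ j ih =>
    rw [birkhoffSum_succ, add_comm, Function.iterate_add_apply, ih, h.iterate_apply,
      Function.iterate_succ_apply']

theorem exists_eq_birkhoffSum {k : ℕ} {b : β} (hk : f^[k] (ι b) ∈ range ι) :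
    ∃ j, k = birkhoffSum g r j b := by
  induction k using Nat.strong_induction_on generalizing b with
  | _ k ih =>
    rcases k.eq_zero_or_pos with rfl | hpos
    · exact ⟨0, by simp⟩
    have hle : r b ≤ k := not_lt.1 fun hlt => h.notMem_range b k hpos hlt hk
    have hpos' := h.pos b
    obtain ⟨j, hj⟩ := ih (k - r b) (by omega) (b := g b) <| by
      rwa [← h.iterate_apply, ← Function.iterate_add_apply, Nat.sub_add_cancel hle]
    exact ⟨j + 1, by rw [birkhoffSum_succ', ← hj]; omega⟩

theorem exists_iterate_eq (hι : Function.Injective ι) {k : ℕ} {a b : β}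
    (hk : f^[k] (ι a) = ι b) : ∃ j, g^[j] a = b := by
  obtain ⟨j, rfl⟩ := h.exists_eq_birkhoffSum ⟨b, hk.symm⟩
  exact ⟨j, hι (by rw [← h.iterate_birkhoffSum, hk])⟩

theorem minimalPeriod_eq (hι : Function.Injective ι) {b : β} (hb : b ∈ Function.periodicPts g) :
    Function.minimalPeriod f (ι b) = birkhoffSum g r (Function.minimalPeriod g b) b := by
  have hpos : 0 < birkhoffSum g r (Function.minimalPeriod g b) b :=
    Finset.sum_pos (fun _ _ => h.pos _)
      ⟨0, Finset.mem_range.2 (Function.minimalPeriod_pos_of_mem_periodicPts hb)⟩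
  have hper : Function.IsPeriodicPt f (birkhoffSum g r (Function.minimalPeriod g b) b) (ι b) := by
    rw [Function.IsPeriodicPt, Function.IsFixedPt, h.iterate_birkhoffSum,
      Function.iterate_minimalPeriod]
  refine le_antisymm (hper.minimalPeriod_le hpos) ?_
  have hreturn := Function.iterate_minimalPeriod (f := f) (x := ι b)
  obtain ⟨j, hj⟩ := h.exists_eq_birkhoffSum ⟨b, hreturn.symm⟩
  have hjpos : 0 < j := by
    refine Nat.pos_of_ne_zero fun h0 => (hper.minimalPeriod_pos hpos).ne' ?_
    rw [hj, h0, birkhoffSum_zero]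
  have hjper : Function.IsPeriodicPt g j b := hι (by rw [← h.iterate_birkhoffSum, ← hj, hreturn])
  rw [hj]
  exact Finset.sum_le_sum_of_subset (Finset.range_mono (hjper.minimalPeriod_le hjpos))

theorem filterMap_iterate_birkhoffSum {γ : Type*} {c : α → Option γ}
    (hc : ∀ a, a ∉ range ι → c a = none) (j : ℕ) (b : β) :
    (List.iterate f (ι b) (birkhoffSum g r j b)).filterMap c =
      (List.iterate g b j).filterMap (c ∘ ι) := by
  have hreturn (b : β) : (List.iterate f (ι b) (r b)).filterMap c = [b].filterMap (c ∘ ι) := by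
    obtain ⟨k, hk⟩ := Nat.exists_eq_add_of_lt (h.pos b)
    have htail : (List.iterate f (f (ι b)) k).filterMap c = [] := by
      refine List.filterMap_eq_nil_iff.2 fun a ha => hc a ?_
      obtain ⟨i, hi, rfl⟩ := List.mem_iterate.1 ha
      exact h.notMem_range b (i + 1) i.succ_pos (by omega)
    rw [hk, zero_add, List.iterate, ← List.singleton_append, List.filterMap_append, htail,
      List.append_nil]
    rfl
  induction j with
  | zero => simp
  | succ j ih =>
    rw [birkhoffSum_succ, List.iterate_add, List.iterate_add, List.filterMap_append,
      List.filterMap_append, ih, h.iterate_birkhoffSum, hreturn]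
    rfl

end IsFirstReturn

open Classical in
theorem dite_choose_eq {α β : Type*} {r : α → β → Prop} (hr : Relator.RightUnique r) {a : α}
    {b : β} (h : r a b) (c : β) : (if h : ∃ b, r a b then h.choose else c) = b := by
  rw [dif_pos ⟨b, h⟩]
  exact hr (Exists.choose_spec ⟨b, h⟩) h

theorem finprod_sumType {α β M : Type*} [Finite α] [Finite β] [CommMonoid M] (f : α ⊕ β → M) :
    ∏ᶠ x, f x = (∏ᶠ a, f (.inl a)) * ∏ᶠ b, f (.inr b) := by
  have := Fintype.ofFinite α
  have := Fintype.ofFinite β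
  simp only [finprod_eq_prod_of_fintype, Fintype.prod_sum_type]

theorem iff_of_quot_mk_eq {α : Sort*} {r : α → α → Prop} {p : α → Prop}
    (hp : ∀ a b, r a b → (p a ↔ p b)) {a b : α} (h : Quot.mk r a = Quot.mk r b) : p a ↔ p b :=
  iff_of_eq (congrArg (Quot.lift p fun a b hab => propext (hp a b hab)) h)

/-! ### Closed components of states -/

namespace ArcData

variable {E : Type} {G : ArcData E}

/-- The laws that hold for the crossings and arcs of every diagram: the partner and mate maps are
involutions, and a frame changes its orientation when its vectors are interchanged. -/
structure IsRegular (G : ArcData E) : Prop where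
  partner_involutive : Function.Involutive G.partner
  turn_partner : ∀ x, G.turn (G.partner x) = !G.turn x
  mate_involutive : Function.Involutive G.mate

/-- The crossing part of a walk: it joins a node to the node from which a walk that arrives there
goes on, which is the other end of a smoothing or of a closure arc. -/
def through (s : G.State) (σ : E → E) : G.Node → G.Node
  | Sum.inl d => Sum.inl (jump s d)
  | Sum.inr e => Sum.inr (σ e)

theorem walk_eq_comp (s : G.State) (σ : E → E) : walk s σ = G.mate ∘ through s σ := by
  funext a
  cases a <;> rfl

theorem through_involutive (hG : G.IsRegular) (s : G.State) {σ : E → E}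
    (hσ : Function.Involutive σ) : Function.Involutive (through s σ) := by
  rintro (⟨x, b⟩ | e)
  · simp only [through, jump, hG.partner_involutive x, s.2]
    cases s.1 x <;> simp
  · rw [through, through, hσ e]

theorem cusp_through (hG : G.IsRegular) (s : G.State) (σ : E → E) (a : G.Node) :
    cusp s (through s σ a) = (cusp s a).map not := by
  rcases a with ⟨x, b⟩ | e
  · simp only [through, jump, cusp, s.2, hG.turn_partner]
    cases s.1 x <;> simp
  · rfl

/-- Two nodes are adjacent in the closed state if they are joined by an arc, by a smoothing or by
a closure arc. -/
def ClosedAdj (s : G.State) (σ : E → E) (a b : G.Node) : Prop :=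
  b = G.mate a ∨ b = through s σ a

/-- The closed components of a state, whose open segments are joined by closure arcs. -/
def ClosedComponent (s : G.State) (σ : E → E) : Type := Quot (ClosedAdj s σ)

theorem mk_mate (s : G.State) (σ : E → E) (a : G.Node) :
    (Quot.mk _ (G.mate a) : ClosedComponent s σ) = Quot.mk _ a :=
  (Quot.sound (.inl rfl)).symm

theorem mk_through (s : G.State) (σ : E → E) (a : G.Node) :
    (Quot.mk _ (through s σ a) : ClosedComponent s σ) = Quot.mk _ a :=
  (Quot.sound (.inr rfl)).symm

theorem mk_iterate_walk (s : G.State) (σ : E → E) (k : ℕ) (a : G.Node) :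
    (Quot.mk _ ((walk s σ)^[k] a) : ClosedComponent s σ) = Quot.mk _ a := by
  induction k with
  | zero => rfl
  | succ k ih =>
    rw [Function.iterate_succ_apply', walk_eq_comp, Function.comp_apply, mk_mate, mk_through,
      ← walk_eq_comp, ih]

theorem cuspWord_eq_filterMap_iterate (s : G.State) (σ : E → E) (a : G.Node) :
    cuspWord s σ a =
      (List.iterate (walk s σ) a (Function.minimalPeriod (walk s σ) a)).filterMap (cusp s) := by
  rw [← List.range_map_iterate, List.filterMap_map]
  rfl

section ClosedWalk

variable (hG : G.IsRegular) (s : G.State) {σ : E → E} (hσ : Function.Involutive σ)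
include hG hσ

theorem cuspWord_mate (a : G.Node) : cuspWord s σ (G.mate a) = reversedWord (cuspWord s σ a) := by
  have hρ := through_involutive hG s hσ
  have hperiod := minimalPeriod_comp_of_involutive hG.mate_involutive hρ a
  have hiterate := listIterate_comp_of_involutive hG.mate_involutive hρ
    (Function.minimalPeriod (G.mate ∘ through s σ) a) a
  rw [Function.iterate_minimalPeriod] at hiterate
  rw [cuspWord_eq_filterMap_iterate, cuspWord_eq_filterMap_iterate, walk_eq_comp, hperiod,
    hiterate, List.filterMap_map, List.filterMap_reverse, reversedWord, List.map_filterMap]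
  exact congrArg List.reverse (List.filterMap_congr fun b _ => cusp_through hG s σ b)

theorem walk_injective : Function.Injective (walk s σ) := by
  rw [walk_eq_comp]
  exact hG.mate_involutive.injective.comp (through_involutive hG s hσ).injective

variable [Finite G.Node]

theorem isRotated_cuspWord_walk (a : G.Node) :
    (cuspWord s σ a).IsRotated (cuspWord s σ (walk s σ a)) := by
  have horbit := Function.periodicOrbit_apply_eq ((walk_injective hG s hσ).mem_periodicPts a)
  have := isRotated_filterMap (cusp s) (Cycle.coe_eq_coe.1 horbit.symm)
  rwa [List.filterMap_map, List.filterMap_map] at this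

theorem survivingPairs_cuspWord_closedAdj {a b : G.Node} (h : ClosedAdj s σ a b) :
    survivingPairs (cuspWord s σ a) = survivingPairs (cuspWord s σ b) := by
  rcases h with rfl | rfl
  · rw [cuspWord_mate hG s hσ, survivingPairs_reversedWord]
  · rw [survivingPairs_congr (eqvGen_cuspMove_of_isRotated (isRotated_cuspWord_walk hG s hσ a)),
      walk_eq_comp, Function.comp_apply, cuspWord_mate hG s hσ, survivingPairs_reversedWord]

/-- In the second case the walk passes `b` in the opposite direction. -/
theorem exists_iterate_walk {a b : G.Node}
    (h : (Quot.mk _ a : ClosedComponent s σ) = Quot.mk _ b) :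
    ∃ k, (walk s σ)^[k] a = b ∨ (walk s σ)^[k] a = through s σ b := by
  have hρ := through_involutive hG s hσ
  let π : Equiv.Perm G.Node := hρ.toPerm.trans hG.mate_involutive.toPerm
  have hπ : ⇑π = walk s σ := (walk_eq_comp s σ).symm
  have sameCycle_mate (c : G.Node) : π.SameCycle a (G.mate c) ↔ π.SameCycle a (through s σ c) := by
    rw [← Equiv.Perm.sameCycle_apply_right (y := through s σ c), hπ, walk_eq_comp,
      Function.comp_apply, hρ]
  have sameCycle_adj (c c' : G.Node) (hadj : ClosedAdj s σ c c') :
      (π.SameCycle a c ∨ π.SameCycle a (through s σ c)) ↔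
        (π.SameCycle a c' ∨ π.SameCycle a (through s σ c')) := by
    rcases hadj with rfl | rfl
    · rw [← sameCycle_mate (G.mate c), sameCycle_mate c, hG.mate_involutive, or_comm]
    · rw [hρ, or_comm]
  have exists_iterate {c : G.Node} (hc : π.SameCycle a c) : ∃ k, (walk s σ)^[k] a = c := by
    obtain ⟨k, -, hk⟩ := hc.exists_pow_eq'
    exact ⟨k, by rw [← hk, Equiv.Perm.coe_pow, hπ]⟩
  rcases (iff_of_quot_mk_eq sameCycle_adj h).1 (.inl (.refl π a)) with hb | hb
  · exact (exists_iterate hb).imp fun _ => .inl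
  · exact (exists_iterate hb).imp fun _ => .inr

end ClosedWalk

/-- The factor of a closed component in the state sum: the variable `K_i` if `2 i` cusps survive on
it. -/
noncomputable def ClosedComponent.weight {s : G.State} {σ : E → E} (c : ClosedComponent s σ) :
    ArrowRing :=
  varK (survivingPairs (cuspWord s σ (Quot.out c)))

theorem ClosedComponent.weight_mk (hG : G.IsRegular) [Finite G.Node] (s : G.State) {σ : E → E}
    (hσ : Function.Involutive σ) (a : G.Node) :
    ClosedComponent.weight (Quot.mk _ a : ClosedComponent s σ) =
      varK (survivingPairs (cuspWord s σ a)) :=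
  congrArg (fun c => varK (Quot.lift (fun a => survivingPairs (cuspWord s σ a))
    (fun _ _ => survivingPairs_cuspWord_closedAdj hG s hσ) c)) (Quot.out_eq (Quot.mk _ a))

/-- Closed components that do not run through a crossing. -/
def ClosedComponent.IsDartFree {s : G.State} {σ : E → E} (c : ClosedComponent s σ) : Prop :=
  ∀ d, c ≠ Quot.mk _ (Sum.inl d)

theorem ClosedComponent.IsDartFree.weight_eq_one {s : G.State} {σ : E → E}
    {c : ClosedComponent s σ} (hc : c.IsDartFree) : c.weight = 1 := by
  have cusp_eq_none (k : ℕ) : cusp s ((walk s σ)^[k] (Quot.out c)) = none := by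
    have hk : Quot.mk _ ((walk s σ)^[k] (Quot.out c)) = c :=
      (mk_iterate_walk s σ k _).trans (Quot.out_eq c)
    rcases h : (walk s σ)^[k] (Quot.out c) with d | e
    · exact absurd (h ▸ hk).symm (hc d)
    · rfl
  have hword : cuspWord s σ (Quot.out c) = [] :=
    List.filterMap_eq_nil_iff.2 fun k _ => cusp_eq_none k
  rw [ClosedComponent.weight, hword, survivingPairs_nil, varK, dif_neg (lt_irrefl 0)]

/-! ### Circular components and segment cycles as closed components -/

theorem iterate_segmentStep_inr (s : G.State) (k : ℕ) (e : E) :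
    (segmentStep s)^[k] (Sum.inr e) = Sum.inr e :=
  Function.iterate_fixed rfl k

theorem tau_eq {s : G.State} {e f : E} {k : ℕ}
    (h : (segmentStep s)^[k] (G.mate (Sum.inr e)) = Sum.inr f) : tau s e = f := by
  refine dite_choose_eq
    (r := fun e e' => ∃ k, (segmentStep s)^[k] (G.mate (Sum.inr e)) = Sum.inr e') ?_ ⟨k, h⟩ e
  have exit_unique (e f f' : E) (j k : ℕ) (hj : (segmentStep s)^[j] (G.mate (Sum.inr e)) = .inr f)
      (hk : (segmentStep s)^[j + k] (G.mate (Sum.inr e)) = .inr f') : f = f' := by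
    rw [add_comm, Function.iterate_add_apply, hj, iterate_segmentStep_inr] at hk
    exact Sum.inr_injective hk
  rintro e f f' ⟨j, hj⟩ ⟨k, hk⟩
  obtain ⟨i, rfl⟩ | ⟨i, rfl⟩ := (le_total j k).imp Nat.exists_eq_add_of_le Nat.exists_eq_add_of_le
  · exact exit_unique e f f' j i hj hk
  · exact (exit_unique e f' f k i hk hj).symm

theorem SegmentCycle.mk_tau (s : G.State) (σ : E → E) (e : E) :
    (Quot.mk _ (tau s e) : SegmentCycle s σ) = Quot.mk _ e :=
  (Quot.sound (.inl rfl)).symm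

theorem SegmentCycle.mk_apply (s : G.State) (σ : E → E) (e : E) :
    (Quot.mk _ (σ e) : SegmentCycle s σ) = Quot.mk _ e :=
  (Quot.sound (.inr rfl)).symm

theorem exists_segmentStep_of_walk {s : G.State} {σ : E → E} {a : G.Node} {k : ℕ} {f : E}
    (h : (walk s σ)^[k] a = Sum.inr f) :
    ∃ j e, (segmentStep s)^[j] a = Sum.inr e ∧ (Quot.mk _ e : SegmentCycle s σ) = Quot.mk _ f := by
  induction k generalizing a with
  | zero => exact ⟨0, f, h, rfl⟩
  | succ k ih =>
    obtain ⟨j, e, hj, hef⟩ := ih h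
    rcases a with d | g
    · exact ⟨j + 1, e, hj, hef⟩
    · refine ⟨0, g, rfl, ?_⟩
      rw [← hef, ← tau_eq hj, SegmentCycle.mk_tau, SegmentCycle.mk_apply]

theorem mk_tau (s : G.State) (σ : E → E) (e : E) :
    (Quot.mk _ (Sum.inr (tau s e)) : ClosedComponent s σ) = Quot.mk _ (Sum.inr e) := by
  have mk_segmentStep (a : G.Node) :
      (Quot.mk _ (segmentStep s a) : ClosedComponent s σ) = Quot.mk _ a := by
    rcases a with d | e
    · exact mk_iterate_walk s σ 1 (Sum.inl d)
    · rfl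
  have mk_iterate (k : ℕ) (a : G.Node) :
      (Quot.mk _ ((segmentStep s)^[k] a) : ClosedComponent s σ) = Quot.mk _ a := by
    induction k with
    | zero => rfl
    | succ k ih => rw [Function.iterate_succ_apply', mk_segmentStep, ih]
  by_cases h : ∃ f k, (segmentStep s)^[k] (G.mate (Sum.inr e)) = Sum.inr f
  · obtain ⟨f, k, hk⟩ := h
    rw [tau_eq hk, ← hk, mk_iterate, mk_mate]
  · rw [tau, dif_neg h]

/-- The closed component of a segment cycle. -/
def SegmentCycle.toClosed (s : G.State) (σ : E → E) : SegmentCycle s σ → ClosedComponent s σ :=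
  Quot.lift (fun e => Quot.mk _ (Sum.inr e)) <| by
    rintro e _ (rfl | rfl)
    · exact (ArcData.mk_tau s σ e).symm
    · exact (mk_through s σ (Sum.inr e)).symm

theorem Adj.mk_eq {s : G.State} (σ : E → E) {a b : G.Node} (h : Adj s a b) :
    (Quot.mk _ a : ClosedComponent s σ) = Quot.mk _ b := by
  rcases h with rfl | ⟨d, rfl, rfl⟩
  · exact (mk_mate s σ a).symm
  · exact (mk_through s σ (Sum.inl d)).symm

/-- The closed component of a circular component. -/
def Circ.toClosed (s : G.State) (σ : E → E) (c : Circ s) : ClosedComponent s σ :=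
  Quot.lift (Quot.mk _) (fun _ _ => Adj.mk_eq σ) c.1

instance (s : G.State) [Finite G.Node] : Finite (Circ s) :=
  Subtype.finite

instance (s : G.State) (σ : E → E) [Finite G.Node] : Finite (ClosedComponent s σ) :=
  inferInstanceAs (Finite (Quot _))

section ToClosed

variable (hG : G.IsRegular) (s : G.State) {σ : E → E} (hσ : Function.Involutive σ)
include hG hσ

theorem SegmentCycle.toClosed_injective [Finite G.Node] :
    Function.Injective (SegmentCycle.toClosed s σ) := by
  have mk_eq {e f : E} {k : ℕ} (h : (walk s σ)^[k] (Sum.inr e) = Sum.inr f) :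
      (Quot.mk _ e : SegmentCycle s σ) = Quot.mk _ f := by
    obtain ⟨j, e', hj, he'⟩ := exists_segmentStep_of_walk h
    rw [iterate_segmentStep_inr] at hj
    rwa [Sum.inr_injective hj]
  rintro ⟨e⟩ ⟨f⟩ h
  obtain ⟨k, hk | hk⟩ := exists_iterate_walk hG s hσ h
  · exact mk_eq hk
  · exact (mk_eq (f := σ f) hk).trans (SegmentCycle.mk_apply s σ f)

theorem mk_adj_eq_of_mk_closedAdj_eq {a b : G.Node}
    (h : (Quot.mk _ a : ClosedComponent s σ) = Quot.mk _ b)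
    (ha : ∀ e : E, (Quot.mk (Adj s) a) ≠ Quot.mk _ (Sum.inr e)) :
    Quot.mk (Adj s) a = Quot.mk _ b := by
  refine (iff_of_quot_mk_eq (p := fun c => Quot.mk (Adj s) a = Quot.mk _ c) ?_ h).1 rfl
  have adj_through {c : G.Node} (hc : Quot.mk (Adj s) a = Quot.mk _ c) :
      Quot.mk (Adj s) a = Quot.mk _ (through s σ c) := by
    rcases c with d | e
    · exact hc.trans (Quot.sound (.inr ⟨d, rfl, rfl⟩))
    · exact absurd hc (ha e)
  rintro c _ (rfl | rfl)
  · rw [Quot.sound (show Adj s c (G.mate c) from .inl rfl)]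
  · refine ⟨adj_through, fun hc => ?_⟩
    simpa only [through_involutive hG s hσ c] using adj_through hc

theorem sumElim_toClosed_bijective [Finite G.Node] :
    Function.Bijective (Sum.elim (Circ.toClosed s σ) (SegmentCycle.toClosed s σ)) := by
  have circ_injective : Function.Injective (Circ.toClosed s σ) := by
    rintro ⟨⟨a⟩, ha⟩ ⟨⟨b⟩, hb⟩ h
    exact Subtype.ext (mk_adj_eq_of_mk_closedAdj_eq hG s hσ h ha)
  refine ⟨circ_injective.sumElim (SegmentCycle.toClosed_injective hG s hσ) ?_, ?_⟩
  · rintro ⟨⟨a⟩, ha⟩ ⟨e⟩ h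
    exact ha e (mk_adj_eq_of_mk_closedAdj_eq hG s hσ h ha)
  · rintro ⟨a⟩
    by_cases h : ∃ e : E, Quot.mk (Adj s) a = Quot.mk _ (Sum.inr e)
    · obtain ⟨e, he⟩ := h
      exact ⟨.inr (Quot.mk _ e), (congrArg (Quot.lift (Quot.mk _) fun _ _ => Adj.mk_eq σ) he).symm⟩
    · exact ⟨.inl ⟨Quot.mk _ a, not_exists.1 h⟩, rfl⟩

theorem card_circ_add_card_segmentCycle [Finite G.Node] :
    Nat.card (Circ s) + Nat.card (SegmentCycle s σ) = Nat.card (ClosedComponent s σ) := by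
  have := Finite.of_injective _ (SegmentCycle.toClosed_injective hG s hσ)
  rw [← Nat.card_sum, Nat.card_eq_of_bijective _ (sumElim_toClosed_bijective hG s hσ)]

theorem finprod_circ_mul_finprod_segmentCycle [Finite G.Node] :
    (∏ᶠ c : Circ s, varK (survivingPairs (cuspWord s σ c.1.out))) *
      (∏ᶠ c : SegmentCycle s σ, varK (survivingPairs (cuspWord s σ (Sum.inr (Quot.out c))))) =
      ∏ᶠ c : ClosedComponent s σ, c.weight := by
  have := Finite.of_injective _ (SegmentCycle.toClosed_injective hG s hσ)
  have weight_circ (c : Circ s) :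
      varK (survivingPairs (cuspWord s σ c.1.out)) = (c.toClosed s σ).weight := by
    conv_rhs => rw [Circ.toClosed, ← Quot.out_eq c.1]
    exact (ClosedComponent.weight_mk hG s hσ _).symm
  have weight_segmentCycle (c : SegmentCycle s σ) :
      varK (survivingPairs (cuspWord s σ (Sum.inr (Quot.out c)))) = (c.toClosed s σ).weight := by
    conv_rhs => rw [← Quot.out_eq c]
    exact (ClosedComponent.weight_mk hG s hσ _).symm
  rw [← finprod_comp_equiv (Equiv.ofBijective _ (sumElim_toClosed_bijective hG s hσ)),
    finprod_sumType]
  exact congrArg₂ _ (finprod_congr weight_circ) (finprod_congr weight_segmentCycle)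

theorem card_circ_of_isEmpty [IsEmpty E] [Finite G.Node] :
    Nat.card (Circ s) = Nat.card (ClosedComponent s σ) := by
  have : IsEmpty (SegmentCycle s σ) := ⟨fun c => isEmptyElim (Quot.out c)⟩
  rw [← card_circ_add_card_segmentCycle hG s hσ, Nat.card_of_isEmpty (α := SegmentCycle s σ),
    add_zero]

theorem finprod_circ_of_isEmpty [IsEmpty E] [Finite G.Node] :
    ∏ᶠ c : Circ s, varK (survivingPairs (cuspWord s σ c.1.out)) =
      ∏ᶠ c : ClosedComponent s σ, c.weight := by
  have : IsEmpty (SegmentCycle s σ) := ⟨fun c => isEmptyElim (Quot.out c)⟩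
  rw [← finprod_circ_mul_finprod_segmentCycle hG s hσ,
    finprod_of_isEmpty (α := SegmentCycle s σ), mul_one]

end ToClosed

end ArcData

/-! ### Joining endpoints -/

namespace ArcData

variable {E : Type} {G : ArcData E} {σ : E → E}

/-- Two nodes are linked if they are the ends of an arc that may run through closure arcs. -/
inductive Link (G : ArcData E) (σ : E → E) : G.Node → G.Node → Prop
  | mate (a : G.Node) : Link G σ a (G.mate a)
  | through (a : G.Node) (e : E) : Link G σ a (Sum.inr e) → Link G σ a (G.mate (Sum.inr (σ e)))

namespace Link

theorem prepend {a b : G.Node} {e : E} (ha : G.mate a = Sum.inr e)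
    (h : Link G σ (Sum.inr (σ e)) b) : Link G σ a b := by
  induction h with
  | mate => exact .through a e (ha ▸ .mate a)
  | through f _ ih => exact ih.through

theorem symm (hG : G.IsRegular) (hσ : Function.Involutive σ) {a b : G.Node} (h : Link G σ a b) :
    Link G σ b a := by
  induction h with
  | mate =>
    have := Link.mate (σ := σ) (G.mate a)
    rwa [hG.mate_involutive] at this
  | through e _ ih => exact prepend (e := σ e) (hG.mate_involutive _) ((hσ e).symm ▸ ih)

theorem mk_eq (s : G.State) {a b : G.Node} (h : Link G σ a b) :
    (Quot.mk _ a : ClosedComponent s σ) = Quot.mk _ b := by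
  induction h with
  | mate => exact (mk_mate s σ a).symm
  | through e _ ih =>
    rw [ih, mk_mate]
    exact (mk_through s σ (Sum.inr e)).symm

end Link

theorem link_through_iterate_walk (s : G.State) (a : G.Node) {k : ℕ} (hk : 0 < k)
    (hend : ∀ i, 0 < i → i < k → ∃ e, (walk s σ)^[i] a = Sum.inr e) :
    Link G σ (through s σ a) ((walk s σ)^[k] a) := by
  induction k, hk using Nat.le_induction with
  | base =>
    rw [Function.iterate_one, walk_eq_comp]
    exact .mate _
  | succ k hk ih =>
    obtain ⟨e, he⟩ := hend k hk k.lt_succ_self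
    have := ih fun i hi hik => hend i hi (hik.trans k.lt_succ_self)
    rw [Function.iterate_succ_apply', he]
    exact .through _ e (he ▸ this)

variable {H : ArcData Empty} {φ : H.Passage ≃ G.Passage}

/-- The nodes of a diagram without endpoints as darts of a diagram with the same passages. -/
def embed (φ : H.Passage ≃ G.Passage) : H.Node → G.Node :=
  Sum.map (Prod.map φ id) Empty.elim

theorem embed_injective : Function.Injective (embed φ) :=
  (φ.injective.prodMap Function.injective_id).sumMap fun e => e.elim

theorem finite_node (φ : H.Passage ≃ G.Passage) [Finite G.Node] : Finite H.Node :=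
  .of_injective _ (embed_injective (φ := φ))

theorem inl_mem_range_embed (d : G.Passage × Bool) : Sum.inl d ∈ range (embed φ) :=
  ⟨Sum.inl (φ.symm d.1, d.2), congrArg Sum.inl (Prod.ext (φ.apply_symm_apply d.1) rfl)⟩

theorem notMem_range_embed_iff {a : G.Node} : a ∉ range (embed φ) ↔ ∃ e, a = Sum.inr e := by
  refine ⟨fun ha => ?_, ?_⟩
  · rcases a with d | e
    · exact absurd (inl_mem_range_embed d) ha
    · exact ⟨e, rfl⟩
  · rintro ⟨e, rfl⟩ ⟨b | b, hb⟩
    · cases hb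
    · exact b.elim

/-- `H` is obtained from `G` by joining its endpoints according to `σ`, where `φ` identifies the
passages through the crossings. -/
structure IsClosure (G : ArcData E) (σ : E → E) (H : ArcData Empty)
    (φ : H.Passage ≃ G.Passage) : Prop where
  regular : G.IsRegular
  involutive : Function.Involutive σ
  partner_eq : ∀ y, φ (H.partner y) = G.partner (φ y)
  turn_eq : ∀ y, H.turn y = G.turn (φ y)
  over_iff : ∀ y, y ∈ H.overSet ↔ φ y ∈ G.overSet
  mate_eq : ∀ a b, Link G σ (embed φ a) (embed φ b) → H.mate a = b

namespace IsClosure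

variable (h : IsClosure G σ H φ)
include h

/-- The states of a diagram and of its closure. -/
def stateEquiv : G.State ≃ H.State :=
  (φ.arrowCongr (Equiv.refl Bool)).symm.subtypeEquiv fun s => by
    simp [φ.surjective.forall, h.partner_eq]

theorem stateEquiv_apply (s : G.State) (y : H.Passage) : (h.stateEquiv s).1 y = s.1 (φ y) := rfl

/-- The passages on the over-strands of a diagram and of its closure. -/
def overEquiv : H.overSet ≃ G.overSet := φ.subtypeEquiv h.over_iff

theorem sign_eq (y : H.overSet) : H.sign y = G.sign (h.overEquiv y) := by
  simp only [sign, h.turn_eq]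
  rfl

theorem writhe_eq : H.writhe = G.writhe := by
  rw [writhe, writhe, ← finsum_comp_equiv h.overEquiv]
  exact finsum_congr h.sign_eq

theorem alpha_eq (s : G.State) : H.alpha (h.stateEquiv s) = G.alpha s := by
  rw [alpha, alpha, ← finsum_comp_equiv h.overEquiv]
  exact finsum_congr fun y => congrArg (· * _) (h.sign_eq y)

theorem embed_through (s : G.State) (a : H.Node) :
    embed φ (through (h.stateEquiv s) id a) = through s σ (embed φ a) := by
  rcases a with ⟨y, b⟩ | e
  · simp only [through, jump, embed, Sum.map_inl, Prod.map_apply, h.partner_eq,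
      h.stateEquiv_apply, id]
    rfl
  · exact e.elim

theorem cusp_embed (s : G.State) : cusp s ∘ embed φ = cusp (h.stateEquiv s) := by
  funext a
  rcases a with ⟨y, b⟩ | e
  · simp only [Function.comp_apply, cusp, embed, Sum.map_inl, Prod.map_apply, h.turn_eq,
      h.stateEquiv_apply]
  · exact e.elim

variable [Finite G.Node]

theorem exists_isFirstReturn_walk (s : G.State) :
    ∃ r, IsFirstReturn (embed φ) (walk s σ) (walk (h.stateEquiv s) id) r := by
  refine exists_isFirstReturn (walk_injective h.regular s h.involutive) fun a k hk hend hret => ?_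
  obtain ⟨b, hb⟩ := hret
  have hlink := link_through_iterate_walk s (embed φ a) hk fun i hi hik =>
    notMem_range_embed_iff.1 (hend i hi hik)
  rw [← hb, ← h.embed_through] at hlink
  rw [← hb, walk_eq_comp, Function.comp_apply, h.mate_eq _ _ hlink]

theorem link_embed_mate (a : H.Node) : Link G σ (embed φ a) (embed φ (H.mate a)) := by
  -- arcs do not depend on the state, so that any state will do
  let s : G.State := ⟨fun _ => true, fun _ => rfl⟩
  obtain ⟨r, hr⟩ := h.exists_isFirstReturn_walk s
  have hthrough : through s σ (embed φ (through (h.stateEquiv s) id a)) = embed φ a := by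
    rw [h.embed_through, through_involutive h.regular s h.involutive]
  have hlink := link_through_iterate_walk s (embed φ (through (h.stateEquiv s) id a)) (hr.pos _)
    fun i hi hir => notMem_range_embed_iff.1 (hr.notMem_range _ i hi hir)
  rw [hr.iterate_apply, hthrough] at hlink
  rwa [h.mate_eq _ _ hlink]

theorem isRegular : H.IsRegular where
  partner_involutive y := φ.injective <| by
    rw [h.partner_eq, h.partner_eq, h.regular.partner_involutive]
  turn_partner y := by rw [h.turn_eq, h.turn_eq, h.partner_eq, h.regular.turn_partner]
  mate_involutive a := h.mate_eq _ _ ((h.link_embed_mate a).symm h.regular h.involutive)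

theorem cuspWord_embed (s : G.State) (a : H.Node) :
    cuspWord s σ (embed φ a) = cuspWord (h.stateEquiv s) id a := by
  have := finite_node φ
  obtain ⟨r, hr⟩ := h.exists_isFirstReturn_walk s
  have hperiodic := (walk_injective h.isRegular (h.stateEquiv s) involutive_id).mem_periodicPts a
  have cusp_eq_none (b : G.Node) (hb : b ∉ range (embed φ)) : cusp s b = none := by
    obtain ⟨e, rfl⟩ := notMem_range_embed_iff.1 hb
    rfl
  rw [cuspWord_eq_filterMap_iterate, cuspWord_eq_filterMap_iterate,
    hr.minimalPeriod_eq embed_injective hperiodic, hr.filterMap_iterate_birkhoffSum cusp_eq_none,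
    h.cusp_embed]

/-- The closed components of a state of `H` as closed components of the corresponding state
of `G`. -/
def mapClosed (s : G.State) : ClosedComponent (h.stateEquiv s) id → ClosedComponent s σ :=
  Quot.lift (fun a => Quot.mk _ (embed φ a)) <| by
    rintro a _ (rfl | rfl)
    · exact (h.link_embed_mate a).mk_eq s
    · rw [h.embed_through, mk_through]

theorem mapClosed_injective (s : G.State) : Function.Injective (h.mapClosed s) := by
  obtain ⟨r, hr⟩ := h.exists_isFirstReturn_walk s
  rintro ⟨a⟩ ⟨b⟩ hab
  obtain ⟨k, hk | hk⟩ := exists_iterate_walk h.regular s h.involutive hab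
  · obtain ⟨j, rfl⟩ := hr.exists_iterate_eq embed_injective hk
    exact (mk_iterate_walk _ _ j a).symm
  · rw [← h.embed_through] at hk
    obtain ⟨j, hj⟩ := hr.exists_iterate_eq embed_injective hk
    exact (mk_iterate_walk _ _ j a).symm.trans ((congrArg _ hj).trans (mk_through _ _ b))

theorem sumElim_mapClosed_bijective (s : G.State) :
    Function.Bijective (Sum.elim (h.mapClosed s)
      (Subtype.val : {c : ClosedComponent s σ // c.IsDartFree} → _)) := by
  refine ⟨(h.mapClosed_injective s).sumElim Subtype.val_injective ?_, fun c => ?_⟩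
  · rintro ⟨d | e⟩ ⟨c, hc⟩
    · exact (hc _).symm
    · exact e.elim
  · by_cases hc : c.IsDartFree
    · exact ⟨.inr ⟨c, hc⟩, rfl⟩
    · obtain ⟨d, rfl⟩ := not_forall_not.1 hc
      obtain ⟨b, hb⟩ := inl_mem_range_embed (φ := φ) d
      exact ⟨.inl (Quot.mk _ b), congrArg (Quot.mk _) hb⟩

theorem weight_mapClosed (s : G.State) (c : ClosedComponent (h.stateEquiv s) id) :
    (h.mapClosed s c).weight = c.weight := by
  have := finite_node φ
  obtain ⟨a⟩ := c
  refine (ClosedComponent.weight_mk h.regular s h.involutive _).trans ?_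
  rw [ClosedComponent.weight_mk h.isRegular _ involutive_id, h.cuspWord_embed]

theorem card_eq (s : G.State) :
    Nat.card (Circ s) + Nat.card (SegmentCycle s σ) = Nat.card (Circ (h.stateEquiv s)) +
      Nat.card {c : ClosedComponent s σ // c.IsDartFree} := by
  have := finite_node φ
  rw [card_circ_add_card_segmentCycle h.regular s h.involutive,
    card_circ_of_isEmpty h.isRegular _ involutive_id, ← Nat.card_sum,
    Nat.card_eq_of_bijective _ (h.sumElim_mapClosed_bijective s)]

theorem finprod_eq (s : G.State) :
    (∏ᶠ c : Circ s, varK (survivingPairs (cuspWord s σ c.1.out))) *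
      ∏ᶠ c : SegmentCycle s σ, varK (survivingPairs (cuspWord s σ (Sum.inr (Quot.out c)))) =
    ∏ᶠ c : Circ (h.stateEquiv s),
      varK (survivingPairs (cuspWord (h.stateEquiv s) id c.1.out)) := by
  have := finite_node φ
  rw [finprod_circ_mul_finprod_segmentCycle h.regular s h.involutive,
    finprod_circ_of_isEmpty h.isRegular _ involutive_id,
    ← finprod_comp_equiv (Equiv.ofBijective _ (h.sumElim_mapClosed_bijective s)), finprod_sumType]
  have dartFree (c : {c : ClosedComponent s σ // c.IsDartFree}) : c.1.weight = 1 :=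
    c.2.weight_eq_one
  exact (congrArg₂ _ (finprod_congr (h.weight_mapClosed s)) (finprod_eq_one_of_forall_eq_one
    dartFree)).trans (mul_one _)

end IsClosure

end ArcData

/-! ### Arcs of linkoid diagrams -/

theorem tripleDet_swap (p u v : EuclideanSpace ℝ (Fin 3)) :
    tripleDet p v u = -tripleDet p u v := by
  simp only [tripleDet, Matrix.det_fin_three, Matrix.of_apply, Matrix.cons_val]
  ring

theorem tripleDet_smul_smul (a b : ℝ) (p u v : EuclideanSpace ℝ (Fin 3)) :
    tripleDet p (a • u) (b • v) = a * b * tripleDet p u v := by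
  simp only [tripleDet, Matrix.det_fin_three, Matrix.of_apply, Matrix.cons_val, PiLp.smul_apply,
    smul_eq_mul]
  ring

namespace LinkoidDiagram

variable {n : ℕ} (L : LinkoidDiagram n) (o : LinkoidOrientation n)

/-- The darts and endpoints of a linkoid diagram, i.e. the nodes of `L.arcData o` for every
orientation `o`. -/
abbrev Node : Type := (L.passages × Bool) ⊕ Fin (2 * n)

theorem finite_passages : Finite L.passages := L.generic.finite.to_subtype

theorem notMem_passages_of_endpoint {x : Fin n × ℝ} (hx : x.2 = 0 ∨ x.2 = 1) :
    x ∉ L.passages := fun ⟨_, y, hy, hne, he⟩ => hne (L.endpoints x y hx hy he)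

theorem mem_Ioo_of_mem_passages {x : Fin n × ℝ} (hx : x ∈ L.passages) : x.2 ∈ Ioo (0 : ℝ) 1 :=
  ⟨hx.1.1.lt_of_ne fun h => L.notMem_passages_of_endpoint (.inl h.symm) hx,
    hx.1.2.lt_of_ne fun h => L.notMem_passages_of_endpoint (.inr h) hx⟩

theorem partner_ne (x : L.passages) : L.partner x ≠ x := (L.exists_partner x).choose_spec.1

theorem curve_partner (x : L.passages) :
    L.curve (L.partner x).1.1 (L.partner x).1.2 = L.curve x.1.1 x.1.2 :=
  (L.exists_partner x).choose_spec.2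

theorem eq_partner {x y : L.passages} (hne : y ≠ x)
    (h : L.curve y.1.1 y.1.2 = L.curve x.1.1 x.1.2) : y = L.partner x := by
  rcases L.generic.no_triple y y.2.1 x x.2.1 (L.partner x) (L.partner x).2.1 h
    (L.curve_partner x).symm with hyx | hx | hy
  · exact absurd (Subtype.ext hyx) hne
  · exact absurd (Subtype.ext hx.symm) (L.partner_ne x)
  · exact Subtype.ext hy

theorem partner_involutive : Function.Involutive L.partner := fun x =>
  (L.eq_partner (L.partner_ne x).symm (L.curve_partner x).symm).symm

theorem tripleDet_velocity_ne_zero (x : L.passages) :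
    tripleDet (L.curve x.1.1 x.1.2) (L.velocity o x.1) (L.velocity o (L.partner x).1) ≠ 0 := by
  have sign_ne_zero (b : Bool) : (if b then (1 : ℝ) else -1) ≠ 0 := by cases b <;> simp
  rw [velocity, velocity, tripleDet_smul_smul]
  exact mul_ne_zero (mul_ne_zero (sign_ne_zero _) (sign_ne_zero _)) <|
    L.generic.transverse x x.2.1 (L.partner x) (L.partner x).2.1
      (fun h => L.partner_ne x (Subtype.ext h.symm)) (L.curve_partner x).symm

theorem turn_partner (x : L.passages) :
    (L.arcData o).turn (L.partner x) = !(L.arcData o).turn x := by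
  have hne := L.tripleDet_velocity_ne_zero o x
  simp only [arcData]
  rw [L.partner_involutive, L.curve_partner, tripleDet_swap, ← decide_not, decide_eq_decide,
    neg_pos, not_lt]
  exact ⟨le_of_lt, fun h => h.lt_of_ne hne⟩

variable {L}

theorem nodeParam_mem_Icc (a : L.Node) : (L.nodeParam a).2 ∈ Icc (0 : ℝ) 1 := by
  rcases a with d | e
  · exact d.1.2.1
  · simp only [nodeParam]
    split_ifs <;> simp

theorem nodeParam_inr_eq (e : Fin (2 * n)) :
    (L.nodeParam (Sum.inr e)).2 = 0 ∨ (L.nodeParam (Sum.inr e)).2 = 1 := by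
  simp only [nodeParam]
  split_ifs <;> simp

theorem nodeParam_mem_passages {a : L.Node} (ha : (L.nodeParam a).2 ∈ Ioo (0 : ℝ) 1) :
    L.nodeParam a ∈ L.passages := by
  rcases a with d | e
  · exact d.1.2
  · rcases nodeParam_inr_eq (L := L) e with h | h
    · exact absurd h ha.1.ne'
    · exact absurd h ha.2.ne

variable {o}

theorem nodeParam_lt_one {a : L.Node} (h : L.increasing o a) : (L.nodeParam a).2 < 1 := by
  rcases a with d | e
  · exact (L.mem_Ioo_of_mem_passages d.1.2).2
  · simp only [increasing] at h
    simp [nodeParam, h]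

theorem nodeParam_pos {a : L.Node} (h : ¬ L.increasing o a) : 0 < (L.nodeParam a).2 := by
  rcases a with d | e
  · exact (L.mem_Ioo_of_mem_passages d.1.2).1
  · simp only [increasing, Bool.not_eq_false] at h
    simp [nodeParam, h]

theorem node_ext {a b : L.Node} (hp : L.nodeParam a = L.nodeParam b)
    (hi : L.increasing o a ↔ L.increasing o b) : a = b := by
  have inl_ne_inr (d : L.passages × Bool) (e : Fin (2 * n)) :
      L.nodeParam (Sum.inl d) ≠ L.nodeParam (Sum.inr e) := fun h =>
    L.notMem_passages_of_endpoint (nodeParam_inr_eq e)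
      (h.subst (motive := (· ∈ L.passages)) d.1.2)
  rcases a with ⟨x, p⟩ | e <;> rcases b with ⟨y, q⟩ | f
  · obtain rfl : x = y := Subtype.ext hp
    obtain rfl : p = q := by cases p <;> cases q <;> grind [increasing]
    rfl
  · exact absurd hp (inl_ne_inr _ _)
  · exact absurd hp.symm (inl_ne_inr _ _)
  · have hcomp : (L.label.symm e).1 = (L.label.symm f).1 := (Prod.ext_iff.1 hp).1
    have hend : (L.label.symm e).2 = (L.label.symm f).2 := by grind [increasing]
    rw [L.label.symm.injective (Prod.ext hcomp hend)]

theorem isArc_rightUnique : Relator.RightUnique (L.IsArc o) := by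
  intro a b c h h'
  wlog hbc : (L.nodeParam b).2 ≤ (L.nodeParam c).2 generalizing b c
  · exact (this h' h (le_of_not_ge hbc)).symm
  obtain ⟨-, hb, he, hlt, -⟩ := h
  obtain ⟨-, hc, he', -, hno⟩ := h'
  rcases hbc.lt_or_eq with hbc | hbc
  · have hp := nodeParam_mem_passages
      ⟨nodeParam_pos hb, hbc.trans_le (nodeParam_mem_Icc c).2⟩
    exact absurd (by rwa [he]) (hno _ ⟨hlt, hbc⟩)
  · exact node_ext (Prod.ext (he.symm.trans he') hbc) (iff_of_false hb hc)

theorem isArc_leftUnique : Relator.LeftUnique (L.IsArc o) := by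
  intro a b c h h'
  wlog hab : (L.nodeParam a).2 ≤ (L.nodeParam b).2 generalizing a b
  · exact (this h' h (le_of_not_ge hab)).symm
  obtain ⟨ha, -, he, -, hno⟩ := h
  obtain ⟨hb, -, he', hlt, -⟩ := h'
  rcases hab.lt_or_eq with hab | hab
  · have hp := nodeParam_mem_passages
      ⟨(nodeParam_mem_Icc a).1.trans_lt hab, nodeParam_lt_one hb⟩
    exact absurd (by rwa [he, ← he']) (hno _ ⟨hab, hlt⟩)
  · exact node_ext (Prod.ext (he.trans he'.symm) hab) (iff_of_true ha hb)

theorem isArc_or_isArc_rightUnique :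
    Relator.RightUnique fun a b => L.IsArc o a b ∨ L.IsArc o b a := by
  rintro a b c (h | h) (h' | h')
  · exact isArc_rightUnique h h'
  · exact absurd h.1 h'.2.1
  · exact absurd h'.1 h.2.1
  · exact isArc_leftUnique h h'

theorem exists_isArc_of_increasing {a : L.Node} (ha : L.increasing o a) : ∃ b, L.IsArc o a b := by
  let later : Set (Fin n × ℝ) :=
    {x | x ∈ L.passages ∧ x.1 = (L.nodeParam a).1 ∧ (L.nodeParam a).2 < x.2}
  have hfin : later.Finite := L.generic.finite.subset fun x hx => hx.1
  rcases later.eq_empty_or_nonempty with hempty | hne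
  · refine ⟨Sum.inr (L.label ((L.nodeParam a).1, true)), ha, by simp [increasing],
      by simp [nodeParam], by simpa [nodeParam] using nodeParam_lt_one ha, fun t ht hp => ?_⟩
    exact eq_empty_iff_forall_notMem.1 hempty _ ⟨hp, rfl, ht.1⟩
  · obtain ⟨x, ⟨hx, hcomp, hlt⟩, hmin⟩ := exists_min_image _ Prod.snd hfin hne
    refine ⟨Sum.inl (⟨x, hx⟩, !o x.1), ha, by simp [increasing], hcomp.symm, hlt,
      fun t ht hp => ?_⟩
    exact (hmin _ ⟨hp, rfl, ht.1⟩).not_gt ht.2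

theorem exists_isArc_of_not_increasing {b : L.Node} (hb : ¬ L.increasing o b) :
    ∃ a, L.IsArc o a b := by
  let earlier : Set (Fin n × ℝ) :=
    {x | x ∈ L.passages ∧ x.1 = (L.nodeParam b).1 ∧ x.2 < (L.nodeParam b).2}
  have hfin : earlier.Finite := L.generic.finite.subset fun x hx => hx.1
  rcases earlier.eq_empty_or_nonempty with hempty | hne
  · refine ⟨Sum.inr (L.label ((L.nodeParam b).1, false)), by simp [increasing], hb,
      by simp [nodeParam], by simpa [nodeParam] using nodeParam_pos hb, fun t ht hp => ?_⟩
    simp only [nodeParam, Equiv.symm_apply_apply] at hp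
    exact eq_empty_iff_forall_notMem.1 hempty _ ⟨hp, rfl, ht.2⟩
  · obtain ⟨x, ⟨hx, hcomp, hlt⟩, hmax⟩ := exists_max_image _ Prod.snd hfin hne
    refine ⟨Sum.inl (⟨x, hx⟩, o x.1), by simp [increasing], hb, hcomp, hlt, fun t ht hp => ?_⟩
    exact (hmax (x.1, t) ⟨hp, hcomp, ht.2⟩).not_gt ht.1

theorem mate_eq {a b : L.Node} (h : L.IsArc o a b ∨ L.IsArc o b a) : (L.arcData o).mate a = b :=
  dite_choose_eq isArc_or_isArc_rightUnique h a

variable (o) in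
theorem isArc_mate (a : L.Node) :
    L.IsArc o a ((L.arcData o).mate a) ∨ L.IsArc o ((L.arcData o).mate a) a := by
  obtain ⟨b, hb⟩ : ∃ b, L.IsArc o a b ∨ L.IsArc o b a := by
    by_cases ha : L.increasing o a
    · exact (exists_isArc_of_increasing ha).imp fun _ => .inl
    · exact (exists_isArc_of_not_increasing ha).imp fun _ => .inr
  rwa [mate_eq hb]

variable (L o) in
theorem arcData_isRegular : (L.arcData o).IsRegular where
  partner_involutive := L.partner_involutive
  turn_partner := L.turn_partner o
  mate_involutive a := mate_eq (isArc_mate o a).symm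

theorem nodeParam_mate_fst (a : L.Node) :
    (L.nodeParam ((L.arcData o).mate a)).1 = (L.nodeParam a).1 := by
  rcases isArc_mate o a with h | h
  · exact h.2.2.1.symm
  · exact h.2.2.1

theorem notMem_passages_of_mem_uIoo {a : L.Node} {t : ℝ}
    (ht : t ∈ uIoo (L.nodeParam a).2 (L.nodeParam ((L.arcData o).mate a)).2) :
    ((L.nodeParam a).1, t) ∉ L.passages := by
  rcases isArc_mate o a with h | h
  · rw [uIoo_of_lt h.2.2.2.1] at ht
    exact h.2.2.2.2 t ht
  · rw [uIoo_of_gt h.2.2.2.1] at ht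
    exact h.2.2.1 ▸ h.2.2.2.2 t ht

variable (L o)

/-- The nodes at which an arc starts, in the sense of the orientation. -/
def IsSource : L.Node → Prop
  | Sum.inl d => d.2 = true
  | Sum.inr e => (L.label.symm e).2 = !o (L.label.symm e).1

/-- The initial endpoint of a component. -/
def initialNode (i : Fin n) : L.Node := Sum.inr (L.label (i, !o i))

/-- The terminal endpoint of a component. -/
def terminalNode (i : Fin n) : L.Node := Sum.inr (L.label (i, o i))

theorem isSource_initialNode (i : Fin n) : L.IsSource o (L.initialNode o i) := by
  simp [IsSource, initialNode]

theorem not_isSource_terminalNode (i : Fin n) : ¬ L.IsSource o (L.terminalNode o i) := by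
  simp [IsSource, terminalNode]

theorem nodeParam_initialNode (i : Fin n) :
    L.nodeParam (L.initialNode o i) = (i, if o i then 0 else 1) := by
  cases h : o i <;> simp [nodeParam, initialNode, h]

theorem nodeParam_terminalNode (i : Fin n) :
    L.nodeParam (L.terminalNode o i) = (i, if o i then 1 else 0) := by
  cases h : o i <;> simp [nodeParam, terminalNode, h]

variable {L o}

theorem eq_initialNode {e : Fin (2 * n)} (h : L.IsSource o (Sum.inr e)) :
    Sum.inr e = L.initialNode o (L.label.symm e).1 := by
  simp only [IsSource] at h
  rw [initialNode, ← h, Prod.mk.eta, Equiv.apply_symm_apply]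

theorem eq_terminalNode {e : Fin (2 * n)} (h : ¬ L.IsSource o (Sum.inr e)) :
    Sum.inr e = L.terminalNode o (L.label.symm e).1 := by
  simp only [IsSource, Bool.not_eq_not] at h
  rw [terminalNode, ← h, Prod.mk.eta, Equiv.apply_symm_apply]

theorem increasing_iff (a : L.Node) :
    L.increasing o a ↔ (L.IsSource o a ↔ o (L.nodeParam a).1 = true) := by
  rcases a with d | e <;> grind [increasing, IsSource, nodeParam]

theorem isSource_mate (a : L.Node) :
    L.IsSource o ((L.arcData o).mate a) ↔ ¬ L.IsSource o a := by
  have hmate := increasing_iff (o := o) ((L.arcData o).mate a)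
  rw [nodeParam_mate_fst] at hmate
  rcases isArc_mate o a with h | h <;> grind [h.1, h.2.1, increasing_iff a]

end LinkoidDiagram

/-! ### Arcs of virtual link diagrams -/

theorem apply_fract_of_periodic {α : Type*} {f : ℝ → α} (hf : Function.Periodic f 1) (t : ℝ) :
    f (Int.fract t) = f t := by
  have := hf.sub_int_mul_eq (x := t) ⌊t⌋
  rwa [mul_one] at this

theorem periodic_deriv {F : Type*} [NormedAddCommGroup F] [NormedSpace ℝ F] {f : ℝ → F} {c : ℝ}
    (hf : Function.Periodic f c) : Function.Periodic (deriv f) c := fun t => by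
  rw [← deriv_comp_add_const, show (fun s => f (s + c)) = f from funext hf]

namespace VirtualLinkDiagram

variable {m : ℕ} (V : VirtualLinkDiagram m)

theorem partner_ne (x : V.passages) : V.partner x ≠ x := (V.exists_partner x).choose_spec.1

theorem curve_partner (x : V.passages) :
    V.curve (V.partner x).1.1 (V.partner x).1.2 = V.curve x.1.1 x.1.2 :=
  (V.exists_partner x).choose_spec.2

theorem eq_partner {x y : V.passages} (hne : y ≠ x)
    (h : V.curve y.1.1 y.1.2 = V.curve x.1.1 x.1.2) : y = V.partner x := by
  rcases V.generic.no_triple y y.2.1.1 x x.2.1.1 (V.partner x) (V.partner x).2.1.1 h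
    (V.curve_partner x).symm with hyx | hx | hy
  · exact absurd (Subtype.ext hyx) hne
  · exact absurd (Subtype.ext hx.symm) (V.partner_ne x)
  · exact Subtype.ext hy

theorem fract_passage (x : V.passages) : Int.fract x.1.2 = x.1.2 := Int.fract_eq_self.2 x.2.1.1

/-- Following the orientation of the circle `i` from the point with parameter `p`, one reaches the
point with parameter `q` without meeting a passage in between.  Both parameters are taken
modulo `1`. -/
def Reaches (i : Fin m) (p q : ℝ) : Prop :=
  ∃ u, p < u ∧ Int.fract u = Int.fract q ∧ ∀ v ∈ Ioo p u, (i, Int.fract v) ∉ V.passages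

variable {V}

namespace Reaches

variable {i : Fin m} {p p' q q' r : ℝ}

theorem congr (hp : Int.fract p = Int.fract p') (hq : Int.fract q = Int.fract q')
    (h : V.Reaches i p q) : V.Reaches i p' q' := by
  obtain ⟨u, hlt, hu, hno⟩ := h
  obtain ⟨z, hz⟩ := Int.fract_eq_fract.1 hp
  refine ⟨u - z, by linarith, by rw [Int.fract_sub_intCast, hu, hq], fun v hv => ?_⟩
  rw [← Int.fract_add_intCast v z]
  exact hno _ ⟨by linarith [hv.1], by linarith [hv.2]⟩

theorem trans (hq : (i, Int.fract q) ∉ V.passages) (hpq : V.Reaches i p q)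
    (hqr : V.Reaches i q r) : V.Reaches i p r := by
  obtain ⟨u, hpu, hu, hno⟩ := hpq
  obtain ⟨w, huw, hw, hno'⟩ := hqr.congr hu.symm rfl
  refine ⟨w, hpu.trans huw, hw, fun v hv => ?_⟩
  rcases lt_trichotomy v u with hvu | rfl | huv
  · exact hno v ⟨hv.1, hvu⟩
  · rwa [hu]
  · exact hno' v ⟨huv, hv.2⟩

theorem right_unique {x y y' : V.passages} (h : V.Reaches x.1.1 x.1.2 y.1.2)
    (h' : V.Reaches x.1.1 x.1.2 y'.1.2) (hc : x.1.1 = y.1.1) (hc' : x.1.1 = y'.1.1) : y = y' := by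
  obtain ⟨u, hu, hf, hno⟩ := h
  obtain ⟨u', hu', hf', hno'⟩ := h'
  rw [V.fract_passage] at hf hf'
  rcases lt_trichotomy u u' with hlt | rfl | hgt
  · exact absurd (by rw [hc, hf]; exact y.2) (hno' u ⟨hu, hlt⟩)
  · exact Subtype.ext (Prod.ext (hc.symm.trans hc') (hf.symm.trans hf'))
  · exact absurd (by rw [hc', hf']; exact y'.2) (hno u' ⟨hu', hgt⟩)

theorem left_unique {x x' y : V.passages} (h : V.Reaches x.1.1 x.1.2 y.1.2)
    (h' : V.Reaches x'.1.1 x'.1.2 y.1.2) (hc : x.1.1 = x'.1.1) : x = x' := by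
  obtain ⟨u, hu, hf, hno⟩ := h
  obtain ⟨u', hu', hf', hno'⟩ := h'
  obtain ⟨z, hz⟩ := Int.fract_eq_fract.1 (hf.trans hf'.symm)
  have hx := V.fract_passage x
  have hx' := V.fract_passage x'
  rcases lt_trichotomy x.1.2 (x'.1.2 + z) with hlt | heq | hgt
  · refine absurd ?_ (hno (x'.1.2 + z) ⟨hlt, by linarith⟩)
    rw [Int.fract_add_intCast, hx', hc]
    exact x'.2
  · refine Subtype.ext (Prod.ext hc ?_)
    rw [← hx, heq, Int.fract_add_intCast, hx']
  · refine absurd ?_ (hno' (x.1.2 - z) ⟨by linarith, by linarith⟩)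
    rw [Int.fract_sub_intCast, hx, ← hc]
    exact x.2

end Reaches

theorem isArc_iff {a b : (V.passages × Bool) ⊕ Empty} :
    V.IsArc a b ↔ ∃ x y : V.passages, a = Sum.inl (x, true) ∧ b = Sum.inl (y, false) ∧
      x.1.1 = y.1.1 ∧ V.Reaches x.1.1 x.1.2 y.1.2 := by
  constructor
  · rcases a with ⟨x, p⟩ | e <;> rcases b with ⟨y, q⟩ | e <;> try exact False.elim
    rintro ⟨rfl, rfl, hc, u, hu, hf, hno⟩
    exact ⟨x, y, rfl, rfl, hc, u, hu, hf.trans (V.fract_passage y).symm, hno⟩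
  · rintro ⟨x, y, rfl, rfl, hc, u, hu, hf, hno⟩
    exact ⟨rfl, rfl, hc, u, hu, hf.trans (V.fract_passage y), hno⟩

theorem isArc_or_isArc_rightUnique : Relator.RightUnique fun a b => V.IsArc a b ∨ V.IsArc b a := by
  simp only [isArc_iff]
  rintro a b c (⟨x, y, rfl, rfl, hc, h⟩ | ⟨x, y, rfl, rfl, hc, h⟩)
    (⟨x', y', ha, rfl, hc', h'⟩ | ⟨x', y', rfl, ha, hc', h'⟩) <;> cases ha
  · rw [h.right_unique h' hc hc']
  · rw [h.left_unique h' (hc.trans hc'.symm)]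

theorem mate_eq {a b : (V.passages × Bool) ⊕ Empty} (h : V.IsArc a b ∨ V.IsArc b a) :
    V.arcData.mate a = b :=
  dite_choose_eq isArc_or_isArc_rightUnique h a

end VirtualLinkDiagram

/-! ### Virtual closures -/

namespace VirtualClosure

variable {n m : ℕ} {L : LinkoidDiagram n} {σ : Equiv.Perm (Fin (2 * n))}
  {o : LinkoidOrientation n} {V : VirtualLinkDiagram m} (hV : VirtualClosure L σ o V)

theorem continuousOn_repar (i : Fin n) : ContinuousOn (hV.repar i) (Icc 0 1) :=
  (hV.repar_smooth i).continuousOn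

theorem deriv_repar_pos (i : Fin n) {t : ℝ} (ht : t ∈ Ioo (0 : ℝ) 1) :
    0 < (if o i then (1 : ℝ) else -1) * deriv (hV.repar i) t := by
  rw [← derivWithin_of_mem_nhds (Icc_mem_nhds ht.1 ht.2)]
  exact hV.repar_orientation i t (Ioo_subset_Icc_self ht)

theorem strictMonoOn_repar {i : Fin n} (h : o i = true) :
    StrictMonoOn (hV.repar i) (Icc 0 1) := by
  refine strictMonoOn_of_deriv_pos (convex_Icc 0 1) (hV.continuousOn_repar i) fun t ht => ?_
  rw [interior_Icc] at ht
  simpa [h] using hV.deriv_repar_pos i ht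

theorem strictAntiOn_repar {i : Fin n} (h : o i = false) :
    StrictAntiOn (hV.repar i) (Icc 0 1) := by
  refine strictAntiOn_of_deriv_neg (convex_Icc 0 1) (hV.continuousOn_repar i) fun t ht => ?_
  rw [interior_Icc] at ht
  simpa [h] using hV.deriv_repar_pos i ht

theorem exists_repar_eq {i : Fin n} {s t v : ℝ} (hs : s ∈ Icc (0 : ℝ) 1) (ht : t ∈ Icc (0 : ℝ) 1)
    (hv : v ∈ Ioo (hV.repar i s) (hV.repar i t)) : ∃ r ∈ uIoo s t, hV.repar i r = v := by
  have hcont := (hV.continuousOn_repar i).mono (uIcc_subset_Icc hs ht)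
  rcases le_total s t with hst | hts
  · rw [uIcc_of_le hst] at hcont
    rw [uIoo_of_le hst]
    exact intermediate_value_Ioo hst hcont hv
  · rw [uIcc_of_ge hts] at hcont
    rw [uIoo_of_ge hts]
    exact intermediate_value_Ioo' hts hcont hv

/-- The parameter in `V` of a point of `L`. -/
noncomputable def param (x : Fin n × ℝ) : Fin m × ℝ :=
  (hV.comp x.1, Int.fract (hV.repar x.1 x.2))

theorem param_mem (x : Fin n × ℝ) : (hV.param x).2 ∈ Ico (0 : ℝ) 1 :=
  ⟨Int.fract_nonneg _, Int.fract_lt_one _⟩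

theorem param_injOn {x y : Fin n × ℝ} (hx : x.2 ∈ Icc (0 : ℝ) 1) (hy : y.2 ∈ Icc (0 : ℝ) 1)
    (h : hV.param x = hV.param y) : x = y := by
  obtain ⟨hcomp, hfract⟩ := Prod.ext_iff.1 h
  obtain ⟨h1, h2⟩ := hV.disjoint x.1 y.1 x.2 hx y.2 hy hcomp hfract
  exact Prod.ext h1 h2

theorem curve_param {x : Fin n × ℝ} (hx : x.2 ∈ Icc (0 : ℝ) 1) :
    V.curve (hV.param x).1 (hV.param x).2 = L.curve x.1 x.2 := by
  rw [param, apply_fract_of_periodic (V.periodic _), hV.curve_eq x.1 x.2 hx]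

theorem exists_param_of_mem_passages {y : Fin m × ℝ} (hy : y ∈ V.passages) :
    ∃ x : Fin n × ℝ, x.2 ∈ Icc (0 : ℝ) 1 ∧ hV.param x = y := by
  obtain ⟨⟨hy, z, hz, hne, he⟩, hv⟩ := hy
  obtain ⟨⟨i, t, ht, h⟩, -⟩ := (hV.classical_iff y z hy hz hne.symm he.symm).1 hv
  exact ⟨(i, t), ht, h.symm⟩

theorem param_mem_passages_iff {x : Fin n × ℝ} (hx : x.2 ∈ Icc (0 : ℝ) 1) :
    hV.param x ∈ V.passages ↔ x ∈ L.passages := by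
  constructor
  · rintro ⟨⟨hpx, y, hy, hne, he⟩, hv⟩
    obtain ⟨-, j, s, hs, rfl⟩ := (hV.classical_iff (hV.param x) y hpx hy hne.symm he.symm).1 hv
    refine ⟨hx, (j, s), hs, fun h => hne (congrArg hV.param h), ?_⟩
    exact (hV.curve_param (x := (j, s)) hs).symm.trans (he.trans (hV.curve_param hx))
  · rintro ⟨-, y, hy, hne, he⟩
    have hne' : hV.param y ≠ hV.param x := fun h => hne (hV.param_injOn hy hx h)
    have he' : V.curve (hV.param y).1 (hV.param y).2 = V.curve (hV.param x).1 (hV.param x).2 := by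
      rw [hV.curve_param hx, hV.curve_param hy]
      exact he
    refine ⟨⟨hV.param_mem x, hV.param y, hV.param_mem y, hne', he'⟩, ?_⟩
    exact (hV.classical_iff _ _ (hV.param_mem x) (hV.param_mem y) hne'.symm he'.symm).2
      ⟨⟨x.1, x.2, hx, rfl⟩, ⟨y.1, y.2, hy, rfl⟩⟩

/-- The passages of a virtual closure through its classical crossings are those of the linkoid
diagram. -/
noncomputable def passageEquiv : V.passages ≃ L.passages :=
  (Equiv.ofBijective
    (fun x : L.passages => (⟨hV.param x, (hV.param_mem_passages_iff x.2.1).2 x.2⟩ : V.passages))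
    ⟨fun x y h => Subtype.ext (hV.param_injOn x.2.1 y.2.1 (congrArg Subtype.val h)), fun y => by
      obtain ⟨x, hx, hxy⟩ := hV.exists_param_of_mem_passages y.2
      exact ⟨⟨x, (hV.param_mem_passages_iff hx).1 (hxy ▸ y.2)⟩, Subtype.ext hxy⟩⟩).symm

theorem param_passageEquiv (y : V.passages) : hV.param (hV.passageEquiv y) = y :=
  congrArg Subtype.val (hV.passageEquiv.symm_apply_apply y)

theorem curve_passageEquiv (y : V.passages) :
    L.curve (hV.passageEquiv y).1.1 (hV.passageEquiv y).1.2 = V.curve y.1.1 y.1.2 := by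
  rw [← hV.curve_param (hV.passageEquiv y).2.1, hV.param_passageEquiv]

theorem passageEquiv_partner (y : V.passages) :
    hV.passageEquiv (V.partner y) = L.partner (hV.passageEquiv y) :=
  L.eq_partner (hV.passageEquiv.injective.ne (V.partner_ne y)) <| by
    rw [hV.curve_passageEquiv, hV.curve_passageEquiv, V.curve_partner]

theorem exists_velocity_eq {x : Fin n × ℝ} (hx : x.2 ∈ Icc (0 : ℝ) 1) :
    ∃ c : ℝ, 0 < c ∧ L.velocity o x = c • deriv (V.curve (hV.param x).1) (hV.param x).2 := by
  refine ⟨_, hV.repar_orientation x.1 x.2 hx, ?_⟩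
  have curve_deriv : HasDerivAt (V.curve (hV.comp x.1)) _ (hV.repar x.1 x.2) :=
    (((V.smooth _).differentiable (by simp)) _).hasDerivAt
  have repar_deriv : HasDerivWithinAt (hV.repar x.1) _ (Icc 0 1) x.2 :=
    ((hV.repar_smooth x.1).differentiableOn (by simp) x.2 hx).hasDerivWithinAt
  have chain_rule := (curve_deriv.scomp_hasDerivWithinAt x.2 repar_deriv).congr
    (fun t ht => (hV.curve_eq x.1 t ht).symm) (hV.curve_eq x.1 x.2 hx).symm
  rw [LinkoidDiagram.velocity, param, apply_fract_of_periodic (periodic_deriv (V.periodic _)),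
    mul_smul, chain_rule.derivWithin (uniqueDiffOn_Icc zero_lt_one x.2 hx)]

theorem turn_eq (y : V.passages) :
    V.arcData.turn y = (L.arcData o).turn (hV.passageEquiv y) := by
  obtain ⟨a, ha, hx⟩ := hV.exists_velocity_eq (hV.passageEquiv y).2.1
  obtain ⟨b, hb, hy⟩ := hV.exists_velocity_eq (hV.passageEquiv (V.partner y)).2.1
  rw [hV.param_passageEquiv] at hx hy
  simp only [VirtualLinkDiagram.arcData, LinkoidDiagram.arcData]
  rw [← hV.passageEquiv_partner, hx, hy, tripleDet_smul_smul, hV.curve_passageEquiv,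
    decide_eq_decide, mul_pos_iff_of_pos_left (mul_pos ha hb)]

theorem overSet_iff (y : V.passages) :
    y ∈ V.arcData.overSet ↔ hV.passageEquiv y ∈ (L.arcData o).overSet := by
  refine Iff.trans ?_ (hV.over_iff (hV.passageEquiv y) (hV.passageEquiv y).2)
  exact iff_of_eq (congrArg (· ∈ V.overSet) (hV.param_passageEquiv y).symm)

/-- The circle of `V` that runs through a node of `L`. -/
noncomputable def circle (a : L.Node) : Fin m := hV.comp (L.nodeParam a).1

/-- The position of a node of `L` on the line that covers its circle. -/
noncomputable def position (a : L.Node) : ℝ := hV.repar (L.nodeParam a).1 (L.nodeParam a).2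

theorem circle_mate (a : L.Node) : hV.circle ((L.arcData o).mate a) = hV.circle a :=
  congrArg hV.comp (LinkoidDiagram.nodeParam_mate_fst a)

theorem circle_initialNode (i : Fin n) : hV.circle (L.initialNode o i) = hV.comp i := by
  rw [circle, L.nodeParam_initialNode]

theorem circle_terminalNode (i : Fin n) : hV.circle (L.terminalNode o i) = hV.comp i := by
  rw [circle, L.nodeParam_terminalNode]

theorem inl_mem_passages (d : L.passages × Bool) :
    (hV.circle (Sum.inl d), Int.fract (hV.position (Sum.inl d))) ∈ V.passages :=
  (hV.param_mem_passages_iff d.1.2.1).2 d.1.2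

theorem inr_notMem_passages (e : Fin (2 * n)) :
    (hV.circle (Sum.inr e), Int.fract (hV.position (Sum.inr e))) ∉ V.passages := fun h =>
  L.notMem_passages_of_endpoint (LinkoidDiagram.nodeParam_inr_eq e)
    ((hV.param_mem_passages_iff (LinkoidDiagram.nodeParam_mem_Icc _)).1 h)

theorem position_lt_position_mate {a : L.Node} (ha : L.IsSource o a) :
    hV.position a < hV.position ((L.arcData o).mate a) := by
  have hinc := LinkoidDiagram.increasing_iff (o := o) a
  rw [iff_true_left ha] at hinc
  have hIcc := LinkoidDiagram.nodeParam_mem_Icc a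
  have hIcc' := LinkoidDiagram.nodeParam_mem_Icc ((L.arcData o).mate a)
  simp only [position, LinkoidDiagram.nodeParam_mate_fst]
  rcases LinkoidDiagram.isArc_mate o a with h | h
  · exact hV.strictMonoOn_repar (hinc.1 h.1) hIcc hIcc' h.2.2.2.1
  · exact hV.strictAntiOn_repar (Bool.eq_false_iff.2 (mt hinc.2 h.2.1)) hIcc' hIcc h.2.2.2.1

theorem reaches_mate {a : L.Node} (ha : L.IsSource o a) :
    V.Reaches (hV.circle a) (hV.position a) (hV.position ((L.arcData o).mate a)) := by
  refine ⟨_, hV.position_lt_position_mate ha, rfl, fun v hv hp => ?_⟩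
  have hIcc := LinkoidDiagram.nodeParam_mem_Icc a
  have hIcc' := LinkoidDiagram.nodeParam_mem_Icc ((L.arcData o).mate a)
  simp only [position, LinkoidDiagram.nodeParam_mate_fst] at hv
  obtain ⟨r, hr, rfl⟩ := hV.exists_repar_eq hIcc hIcc' hv
  have hrIcc : r ∈ Icc (0 : ℝ) 1 := uIcc_subset_Icc hIcc hIcc' (uIoo_subset_uIcc_self hr)
  exact LinkoidDiagram.notMem_passages_of_mem_uIoo hr
    ((hV.param_mem_passages_iff (x := ((L.nodeParam a).1, r)) hrIcc).1 hp)

/-- The component of `L` that comes after the component `i` on its circle. -/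
noncomputable def next (i : Fin n) : Fin n := (hV.closure_arc i).choose

theorem perm_label (i : Fin n) : σ (L.label (i, o i)) = L.label (hV.next i, !o (hV.next i)) :=
  let ⟨_, h⟩ := (hV.closure_arc i).choose_spec; h.1

theorem comp_next (i : Fin n) : hV.comp (hV.next i) = hV.comp i :=
  let ⟨_, h⟩ := (hV.closure_arc i).choose_spec; h.2.1

theorem exists_position_next (i : Fin n) : ∃ u, hV.position (L.terminalNode o i) < u ∧
    Int.fract u = Int.fract (hV.position (L.initialNode o (hV.next i))) ∧
    ∀ v ∈ Ioo (hV.position (L.terminalNode o i)) u, ∀ x : Fin n × ℝ, x.2 ∈ Icc (0 : ℝ) 1 →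
      hV.param x ≠ (hV.comp i, Int.fract v) := by
  obtain ⟨u, -, -, hu, hfract, hno⟩ := (hV.closure_arc i).choose_spec
  simp only [position, L.nodeParam_initialNode, L.nodeParam_terminalNode]
  refine ⟨u, hu, hfract, fun v hv x hx h => ?_⟩
  obtain ⟨hcomp, hx'⟩ := Prod.ext_iff.1 h
  exact hno v hv x.1 x.2 hx hcomp hx'.symm

theorem reaches_next (i : Fin n) : V.Reaches (hV.comp i) (hV.position (L.terminalNode o i))
    (hV.position (L.initialNode o (hV.next i))) := by
  obtain ⟨u, hu, hfract, hno⟩ := hV.exists_position_next i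
  refine ⟨u, hu, hfract, fun v hv hp => ?_⟩
  obtain ⟨x, hx, h⟩ := hV.exists_param_of_mem_passages hp
  exact hno v hv x hx h

theorem next_surjective : Function.Surjective hV.next := by
  refine Finite.surjective_of_injective fun i j hij => ?_
  have h : σ (L.label (i, o i)) = σ (L.label (j, o j)) := by
    rw [hV.perm_label, hV.perm_label, hij]
  exact (Prod.ext_iff.1 (L.label.injective (σ.injective h))).1

theorem exists_ends_closureArc (hσ : Function.Involutive σ) (e : Fin (2 * n)) : ∃ i,
    (Sum.inr e = L.terminalNode o i ∧ Sum.inr (σ e) = L.initialNode o (hV.next i)) ∨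
      (Sum.inr e = L.initialNode o (hV.next i) ∧ Sum.inr (σ e) = L.terminalNode o i) := by
  obtain ⟨⟨i, p⟩, rfl⟩ := L.label.surjective e
  rcases Bool.eq_or_eq_not p (o i) with rfl | rfl
  · exact ⟨i, .inl ⟨rfl, congrArg Sum.inr (hV.perm_label i)⟩⟩
  · obtain ⟨j, rfl⟩ := hV.next_surjective i
    refine ⟨j, .inr ⟨rfl, ?_⟩⟩
    rw [← hV.perm_label, hσ, LinkoidDiagram.terminalNode]

theorem circle_perm (hσ : Function.Involutive σ) (e : Fin (2 * n)) :
    hV.circle (Sum.inr (σ e)) = hV.circle (Sum.inr e) := by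
  obtain ⟨i, h | h⟩ := hV.exists_ends_closureArc hσ e <;>
    rw [h.1, h.2, circle_initialNode, circle_terminalNode, comp_next]

include hV in
theorem isSource_perm (hσ : Function.Involutive σ) (e : Fin (2 * n)) :
    L.IsSource o (Sum.inr (σ e)) ↔ ¬ L.IsSource o (Sum.inr e) := by
  have hinit := L.isSource_initialNode o
  have hterm := L.not_isSource_terminalNode o
  obtain ⟨i, h | h⟩ := hV.exists_ends_closureArc hσ e <;> rw [h.1, h.2]
  · exact iff_of_true (hinit _) (hterm i)
  · exact iff_of_false (hterm i) (not_not.2 (hinit _))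

include hV in
theorem isSource_of_link (hσ : Function.Involutive σ) {a b : (L.arcData o).Node}
    (h : ArcData.Link (L.arcData o) σ a b) : L.IsSource o b ↔ ¬ L.IsSource o a := by
  induction h with
  | mate => exact LinkoidDiagram.isSource_mate _
  | through e _ ih =>
    exact (LinkoidDiagram.isSource_mate _).trans
      (not_congr ((hV.isSource_perm hσ e).trans (not_congr ih) |>.trans not_not))

theorem circle_eq_of_link (hσ : Function.Involutive σ) {a b : (L.arcData o).Node}
    (h : ArcData.Link (L.arcData o) σ a b) : hV.circle b = hV.circle a := by
  induction h with
  | mate => exact hV.circle_mate _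
  | through e _ ih => exact (hV.circle_mate _).trans ((hV.circle_perm hσ e).trans ih)

theorem reaches_of_link (hσ : Function.Involutive σ) {a b : (L.arcData o).Node}
    (h : ArcData.Link (L.arcData o) σ a b) (ha : L.IsSource o a) :
    V.Reaches (hV.circle a) (hV.position a) (hV.position b) := by
  induction h with
  | mate => exact hV.reaches_mate ha
  | through e h ih =>
    have hcirc := hV.circle_eq_of_link hσ h
    have he : ¬ L.IsSource o (Sum.inr e) := fun he => (hV.isSource_of_link hσ h).1 he ha
    obtain ⟨i, ⟨hi, hσe⟩ | ⟨hi, -⟩⟩ := hV.exists_ends_closureArc hσ e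
    · have hcirc' := (hV.circle_perm hσ e).trans hcirc
      have hcomp : hV.comp i = hV.circle a :=
        ((hV.circle_terminalNode i).symm.trans (congrArg hV.circle hi.symm)).trans hcirc
      have hreach := hV.reaches_next i
      rw [hcomp, ← hi, ← hσe] at hreach
      have hreach' := hV.reaches_mate (hσe ▸ L.isSource_initialNode o (hV.next i))
      exact (ih.trans (hcirc ▸ hV.inr_notMem_passages e) hreach).trans
        (hcirc' ▸ hV.inr_notMem_passages (σ e)) (hcirc' ▸ hreach')
    · exact absurd (hi ▸ L.isSource_initialNode o _) he

theorem isArc_of_link (hσ : Function.Involutive σ) {a b : V.arcData.Node}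
    (h : ArcData.Link (L.arcData o) σ (ArcData.embed hV.passageEquiv a)
      (ArcData.embed hV.passageEquiv b))
    (ha : L.IsSource o (ArcData.embed (G := L.arcData o) hV.passageEquiv a)) : V.IsArc a b := by
  have hb := mt (hV.isSource_of_link hσ h).1 (not_not.2 ha)
  have hcirc := hV.circle_eq_of_link hσ h
  have hreach := hV.reaches_of_link hσ h ha
  rcases a with ⟨x, p⟩ | e
  · rcases b with ⟨y, q⟩ | e
    · obtain rfl : p = true := ha
      obtain rfl : q = false := Bool.eq_false_iff.2 hb
      obtain ⟨hcx, hfx⟩ := Prod.ext_iff.1 (hV.param_passageEquiv x)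
      obtain ⟨hcy, hfy⟩ := Prod.ext_iff.1 (hV.param_passageEquiv y)
      refine VirtualLinkDiagram.isArc_iff.2
        ⟨x, y, rfl, rfl, hcx.symm.trans (hcirc.symm.trans hcy), ?_⟩
      rw [← hcx]
      exact hreach.congr (hfx.trans (V.fract_passage x).symm) (hfy.trans (V.fract_passage y).symm)
    · exact e.elim
  · exact e.elim

theorem isClosure (hσ : Function.Involutive σ) :
    ArcData.IsClosure (L.arcData o) σ V.arcData hV.passageEquiv where
  regular := L.arcData_isRegular o
  involutive := hσ
  partner_eq := hV.passageEquiv_partner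
  turn_eq := hV.turn_eq
  over_iff := hV.overSet_iff
  mate_eq a b h := by
    refine VirtualLinkDiagram.mate_eq ?_
    by_cases ha : L.IsSource o (ArcData.embed (G := L.arcData o) hV.passageEquiv a)
    · exact .inl (hV.isArc_of_link hσ h ha)
    · exact .inr (hV.isArc_of_link hσ (h.symm (L.arcData_isRegular o) hσ)
        ((hV.isSource_of_link hσ h).2 ha))

theorem position_initialNode_lt (i : Fin n) :
    hV.position (L.initialNode o i) < hV.position (L.terminalNode o i) := by
  have h0 : (0 : ℝ) ∈ Icc (0 : ℝ) 1 := left_mem_Icc.2 zero_le_one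
  have h1 : (1 : ℝ) ∈ Icc (0 : ℝ) 1 := right_mem_Icc.2 zero_le_one
  simp only [position, L.nodeParam_initialNode, L.nodeParam_terminalNode]
  cases h : o i
  · exact hV.strictAntiOn_repar h h0 h1 zero_lt_one
  · exact hV.strictMonoOn_repar h h0 h1 zero_lt_one

theorem mem_image_repar {i : Fin n} {v : ℝ}
    (hv : v ∈ Icc (hV.position (L.initialNode o i)) (hV.position (L.terminalNode o i))) :
    v ∈ hV.repar i '' Icc 0 1 := by
  simp only [position, L.nodeParam_initialNode, L.nodeParam_terminalNode] at hv
  cases h : o i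
  · exact intermediate_value_Icc' zero_le_one (hV.continuousOn_repar i) (by simpa [h] using hv)
  · exact intermediate_value_Icc zero_le_one (hV.continuousOn_repar i) (by simpa [h] using hv)

/-- The distance from the terminal endpoint of the component `i` to the initial endpoint of the
component `k`, if the two lie on the same circle and its orientation is followed. -/
noncomputable def gap (i k : Fin n) : ℝ :=
  Int.fract (hV.position (L.initialNode o k) - hV.position (L.terminalNode o i))

theorem fract_position_add_gap (i k : Fin n) :
    Int.fract (hV.position (L.terminalNode o i) + hV.gap i k) =
      Int.fract (hV.position (L.initialNode o k)) := by
  refine Int.fract_eq_fract.2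
    ⟨-⌊hV.position (L.initialNode o k) - hV.position (L.terminalNode o i)⌋, ?_⟩
  rw [gap, Int.fract, Int.cast_neg]
  ring

theorem gap_pos {i k : Fin n} (hk : hV.comp k = hV.comp i) : 0 < hV.gap i k := by
  refine (Int.fract_nonneg _).lt_of_ne' fun h => ?_
  have hfract := hV.fract_position_add_gap i k
  rw [gap, h, add_zero] at hfract
  have hcirc := (hV.circle_initialNode k).trans (hk.trans (hV.circle_terminalNode i).symm)
  have hparam := hV.param_injOn (LinkoidDiagram.nodeParam_mem_Icc (L.initialNode o k))
    (LinkoidDiagram.nodeParam_mem_Icc (L.terminalNode o i)) (Prod.ext hcirc hfract.symm)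
  rw [L.nodeParam_initialNode, L.nodeParam_terminalNode] at hparam
  grind

theorem next_eq_or_gap_lt {i k : Fin n} (hk : hV.comp k = hV.comp i) :
    hV.next i = k ∨ hV.gap (hV.next i) k < hV.gap i k := by
  obtain ⟨u, hpu, hu, hno⟩ := hV.exists_position_next i
  obtain ⟨z, hz⟩ := Int.fract_eq_fract.1 hu
  let q := hV.position (L.terminalNode o i) + hV.gap i k
  have hq : Int.fract q = Int.fract (hV.position (L.initialNode o k)) :=
    hV.fract_position_add_gap i k
  have hIcc := LinkoidDiagram.nodeParam_mem_Icc (L.initialNode o k)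
  have huq : u ≤ q := not_lt.1 fun hlt =>
    hno q ⟨lt_add_of_pos_right _ (hV.gap_pos hk), hlt⟩ (L.nodeParam (L.initialNode o k)) hIcc
      (Prod.ext ((hV.circle_initialNode k).trans hk) hq.symm)
  rcases le_or_gt (q - z) (hV.position (L.terminalNode o (hV.next i))) with hle | hgt
  · obtain ⟨t, ht, hqt⟩ := hV.mem_image_repar ⟨by linarith, hle⟩
    have hcomp : hV.comp (hV.next i) = hV.circle (L.initialNode o k) :=
      (hV.comp_next i).trans (hk.symm.trans (hV.circle_initialNode k).symm)
    have hfract : Int.fract (hV.repar (hV.next i) t) =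
        Int.fract (hV.position (L.initialNode o k)) := by
      rw [hqt, Int.fract_sub_intCast, hq]
    have hparam := hV.param_injOn (x := (hV.next i, t)) ht hIcc (Prod.ext hcomp hfract)
    rw [L.nodeParam_initialNode] at hparam
    exact .inl (Prod.ext_iff.1 hparam).1
  · have hlt := hV.position_initialNode_lt (hV.next i)
    have hgap_lt : hV.gap i k < 1 := Int.fract_lt_one _
    obtain ⟨w, hw⟩ := Int.fract_eq_fract.1 hq.symm
    have hgap : hV.gap (hV.next i) k = q - z - hV.position (L.terminalNode o (hV.next i)) :=
      Int.fract_eq_iff.2 ⟨by linarith, by grind, w + z, by push_cast; linarith⟩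
    right
    grind

/-- Passing from a component to the next one decreases the gap to the component `k`, until `k`
itself is reached. -/
theorem mem_of_mapsTo_next {S : Set (Fin n)} (hS : MapsTo hV.next S S) {i k : Fin n}
    (hk : hV.comp k = hV.comp i) (hi : i ∈ S) : k ∈ S := by
  obtain ⟨j, ⟨hjS, hkj⟩, hmin⟩ := exists_min_image {j | j ∈ S ∧ hV.comp k = hV.comp j}
    (hV.gap · k) (toFinite _) ⟨i, hi, hk⟩
  rcases hV.next_eq_or_gap_lt hkj with h | h
  · exact h ▸ hS hjS
  · exact absurd h (hmin _ ⟨hS hjS, hkj.trans (hV.comp_next j).symm⟩).not_gt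

section FreeCircles

variable (hσ : Function.Involutive σ) {s : (L.arcData o).State}
include hσ

theorem circle_eq_iff_of_mk_eq {i : Fin m} (hi : ∀ t, (i, t) ∉ V.passages)
    {a b : (L.arcData o).Node}
    (h : (Quot.mk _ a : ArcData.ClosedComponent s σ) = Quot.mk _ b) :
    hV.circle a = i ↔ hV.circle b = i := by
  have circle_inl_ne (d : L.passages × Bool) : hV.circle (Sum.inl d) ≠ i := by
    rintro rfl
    exact hi _ (hV.inl_mem_passages d)
  refine iff_of_quot_mk_eq (p := fun a => hV.circle a = i) ?_ h
  rintro a _ (rfl | rfl)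
  · exact iff_of_eq (congrArg (· = i) (hV.circle_mate a).symm)
  · rcases a with d | e
    · exact iff_of_false (circle_inl_ne _) (circle_inl_ne _)
    · exact iff_of_eq (congrArg (· = i) (hV.circle_perm hσ e).symm)

theorem isDartFree_mk {a : (L.arcData o).Node} (ha : ∀ t, (hV.circle a, t) ∉ V.passages) :
    ArcData.ClosedComponent.IsDartFree (Quot.mk _ a : ArcData.ClosedComponent s σ) := fun d h => by
  have hd : hV.circle (Sum.inl d) = hV.circle a := (hV.circle_eq_iff_of_mk_eq hσ ha h).1 rfl
  exact ha _ (hd ▸ hV.inl_mem_passages d)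

end FreeCircles

theorem mk_initialNode_next (s : (L.arcData o).State) (i : Fin n) :
    (Quot.mk _ (L.initialNode o (hV.next i)) : ArcData.ClosedComponent s σ) =
      Quot.mk _ (L.terminalNode o i) :=
  (congrArg (fun e => (Quot.mk _ (Sum.inr e) : ArcData.ClosedComponent s σ))
    (hV.perm_label i).symm).trans (ArcData.mk_through s σ (L.terminalNode o i))

end VirtualClosure

namespace ArcData.ClosedComponent.IsDartFree

variable {n : ℕ} {L : LinkoidDiagram n} {σ : Equiv.Perm (Fin (2 * n))}
  {o : LinkoidOrientation n} {s : (L.arcData o).State} {c : ArcData.ClosedComponent s σ}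
  (hc : c.IsDartFree)
include hc

theorem mate_initialNode {i : Fin n} (h : Quot.mk _ (L.initialNode o i) = c) :
    (L.arcData o).mate (L.initialNode o i) = L.terminalNode o i := by
  have hparam := LinkoidDiagram.nodeParam_mate_fst (o := o) (L.initialNode o i)
  have hsource := LinkoidDiagram.isSource_mate (o := o) (L.initialNode o i)
  have hmk := (ArcData.mk_mate s σ (L.initialNode o i)).trans h
  rcases hmate : (L.arcData o).mate (L.initialNode o i) with d | e
  · exact absurd (hmate ▸ hmk).symm (hc d)
  · rw [hmate] at hparam hsource
    rw [L.nodeParam_initialNode] at hparam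
    have hterm := LinkoidDiagram.eq_terminalNode
      (mt hsource.1 (not_not.2 (L.isSource_initialNode o i)))
    exact hterm.trans (congrArg (L.terminalNode o) hparam)

theorem mk_terminalNode {i : Fin n} (h : Quot.mk _ (L.initialNode o i) = c) :
    Quot.mk _ (L.terminalNode o i) = c :=
  (congrArg (Quot.mk _) (hc.mate_initialNode h)).symm.trans ((ArcData.mk_mate s σ _).trans h)

variable {m : ℕ} {V : VirtualLinkDiagram m} (hV : VirtualClosure L σ o V)
include hV

theorem exists_mk_initialNode : ∃ i, Quot.mk _ (L.initialNode o i) = c := by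
  obtain ⟨d | e⟩ := c
  · exact absurd rfl (hc d)
  · by_cases he : L.IsSource o (Sum.inr e)
    · exact ⟨_, congrArg (Quot.mk _) (LinkoidDiagram.eq_initialNode he).symm⟩
    · exact ⟨_, (hV.mk_initialNode_next s _).trans
        (congrArg (Quot.mk _) (LinkoidDiagram.eq_terminalNode he).symm)⟩

theorem mk_initialNode_of_comp_eq {i k : Fin n} (h : Quot.mk _ (L.initialNode o i) = c)
    (hk : hV.comp k = hV.comp i) : Quot.mk _ (L.initialNode o k) = c :=
  hV.mem_of_mapsTo_next (S := {j | Quot.mk _ (L.initialNode o j) = c})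
    (fun j hj => (hV.mk_initialNode_next s j).trans (hc.mk_terminalNode hj)) hk h

theorem notMem_passages {i : Fin n} (h : Quot.mk _ (L.initialNode o i) = c) (t : ℝ) :
    (hV.comp i, t) ∉ V.passages := by
  intro ht
  obtain ⟨x, hx, hxt⟩ := hV.exists_param_of_mem_passages ht
  have hxL : x ∈ L.passages := (hV.param_mem_passages_iff hx).1 (hxt ▸ ht)
  have hmate := hc.mate_initialNode
    (hc.mk_initialNode_of_comp_eq hV h (Prod.ext_iff.1 hxt).1)
  have hnot : x.2 ∉ uIoo (L.nodeParam (L.initialNode o x.1)).2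
      (L.nodeParam ((L.arcData o).mate (L.initialNode o x.1))).2 := fun hmem =>
    LinkoidDiagram.notMem_passages_of_mem_uIoo hmem (by rwa [L.nodeParam_initialNode])
  rw [hmate, L.nodeParam_initialNode, L.nodeParam_terminalNode] at hnot
  refine hnot ?_
  cases o x.1 <;> simpa using L.mem_Ioo_of_mem_passages hxL

end ArcData.ClosedComponent.IsDartFree

namespace VirtualClosure

theorem card_freeCircles {n m : ℕ} {L : LinkoidDiagram n} {σ : Equiv.Perm (Fin (2 * n))}
    {o : LinkoidOrientation n} {V : VirtualLinkDiagram m} (hV : VirtualClosure L σ o V)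
    (hσ : Function.Involutive σ) (s : (L.arcData o).State) :
    V.freeCircles = Nat.card {c : ArcData.ClosedComponent s σ // c.IsDartFree} := by
  let rep := Function.surjInv hV.comp_surjective
  have circle_rep (i : Fin m) : hV.circle (L.initialNode o (rep i)) = i :=
    (hV.circle_initialNode _).trans (Function.surjInv_eq hV.comp_surjective i)
  let toClosed (i : {i : Fin m // ∀ t : ℝ, (i, t) ∉ V.passages}) :
      {c : ArcData.ClosedComponent s σ // c.IsDartFree} :=
    ⟨Quot.mk _ (L.initialNode o (rep i)), hV.isDartFree_mk hσ ((circle_rep i).symm ▸ i.2)⟩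
  refine Nat.card_eq_of_bijective toClosed ⟨fun i j hij => ?_, fun ⟨c, hc⟩ => ?_⟩
  · have hcirc := (hV.circle_eq_iff_of_mk_eq hσ i.2 (congrArg Subtype.val hij)).1 (circle_rep i)
    exact Subtype.ext (hcirc.symm.trans (circle_rep j))
  · obtain ⟨i, hi⟩ := hc.exists_mk_initialNode hV
    exact ⟨⟨hV.comp i, hc.notMem_passages hV hi⟩, Subtype.ext
      (hc.mk_initialNode_of_comp_eq hV hi (Function.surjInv_eq hV.comp_surjective _))⟩

end VirtualClosure

theorem IsClosurePerm.involutive {n : ℕ} {σ : Equiv.Perm (Fin (2 * n))}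
    (hσ : IsClosurePerm σ) : Function.Involutive σ := fun e => Equiv.congr_fun hσ.1 e

theorem theorem4p4 {n m : ℕ} (L : LinkoidDiagram n) (τ σ : Equiv.Perm (Fin (2 * n)))
    (hτ : L.strandPerm = τ) (hσ : IsClosurePerm σ)
    (o : LinkoidOrientation n) (V : VirtualLinkDiagram m) (hV : VirtualClosure L σ o V) :
    L.arrowPolynomial o σ = V.arrowPolynomial ∧
    writheFactor (L.arcData o).writhe * L.arrowPolynomial o σ =
      writheFactor V.arcData.writhe * V.arrowPolynomial := by
  have h := hV.isClosure hσ.involutive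
  have : Finite (L.arcData o).Passage := L.finite_passages
  have heq : L.arrowPolynomial o σ = V.arrowPolynomial := by
    rw [LinkoidDiagram.arrowPolynomial, VirtualLinkDiagram.arrowPolynomial,
      ← finsum_comp_equiv h.stateEquiv]
    refine finsum_congr fun s => ?_
    rw [h.alpha_eq, LinkoidDiagram.stateK, h.finprod_eq, h.card_eq,
      hV.card_freeCircles hσ.involutive]
  exact ⟨heq, by rw [heq, h.writhe_eq]⟩
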